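/- Notation. For $j\in\mathbb Z$ put $\langle j\rangle=(1+j^2)^{1/2}$. Let $L^2h^1=L^2h^1(\mathbb R^2\times\mathbb Z)$ be the space of sequences $\vec u=\{u_j\}_{j\in\mathbb Z}$ of complex-valued functions $u_j\in L^2(\mathbb R^2)$ with $$\|\vec u\|_{L^2h^1}^2=\int_{\mathbb R^2}\sum_{j\in\mathbb Z}\langle j\rangle^2|u_j(x)|^2\,dx=\sum_{j\in\mathbb Z}\langle j\rangle^2\|u_j\|_{L^2}^2<\infty .$$ Let $G$ be the group of unitary operators on $L^2h^1$ generated by phase rotations, Galilean transforms, translations and dilations (at a fixed time), that is, the group of all operators $$(g_{\theta,\xi_0,x_0,\lambda}\vec u)(x)=\frac1\lambda\, e^{i\theta}e^{ix\cdot\xi_0}\,\vec u\Big(\frac{x-x_0}{\lambda}\Big),\qquad \theta\in\mathbb R,\ \xi_0,x_0\in\mathbb R^2,\ \lambda>0 .$$ Let $G\backslash L^2h^1$ be the space of orbits $G\vec f=\{g\vec f: g\in G\}$ with the quotient topology; a subset is called precompact if its closure is compact. For an interval $I\subset\mathbb R$, a map $\vec u:I\to L^2h^1$ is called almost periodic modulo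 $G$ if its quotiented orbit $\{G\vec u(t):t\in I\}$ is a precompact subset of $G\backslash L^2h^1$. The Fourier transform is $\hat f(\xi)=(2\pi)^{-1}\int_{\mathbb R^2} e^{-ix\cdot\xi}f(x)\,dx$, extended to $L^2(\mathbb R^2)$. Proposition. Let $I\subset\mathbb R$ be an interval and let $\vec u\in C^0_{t,\mathrm{loc}}L^2h^1(I\times\mathbb R^2\times\mathbb Z)$, i.e. $\vec u:I\to L^2h^1$ is continuous. The following statements are equivalent. 1. $\vec u$ is almost periodic modulo $G$. 2. $\{G\vec u(t):t\in I\}$ is precompact in $G\backslash L^2h^1(\mathbb R^2\times\mathbb Z)$. 3. There exist functions $x:I\to\mathbb R^2$, $\xi:I\to\mathbb R^2$ and $N:I\to(0,\infty)$ such that for every $\eta>0$ there exist an integer $K(\eta)>0$ and a real number $R(\eta)>0$ such that for all $t\in I$ $$\sum_{|j|>K(\eta)}\langle j\rangle^2\|u_j(t)\|_{L^2}^2<\eta,$$ $$\sum_{|j|\le K(\eta)}\langle j\rangle^2\int_{|x-x(t)|\ge R(\eta)/N(t)}|u_j(t,x)|^2\,dx<\eta,$$ $$\sum_{|j|\le K(\eta)}\langle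 j\rangle^2\int_{|\xi-\xi(t)|\ge R(\eta)N(t)}|\hat u_j(t,\xi)|^2\,d\xi<\eta .$$ -/

import Mathlib

open MeasureTheory Filter Topology
open scoped ENNReal NNReal FourierTransform InnerProductSpace

noncomputable section

namespace ResonantNLS

/-- The physical space `ℝ²` with its Euclidean norm. -/
abbrev Plane : Type := EuclideanSpace ℝ (Fin 2)

/-- The space `L²(ℝ²; ℂ)` with respect to Lebesgue measure. -/
abbrev L2 : Type := Lp ℂ 2 (volume : Measure Plane)

/-- The Fourier transform of `f ∈ L²(ℝ²)`, normalised as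
`f̂ ξ = (2π)⁻¹ ∫ e^{-i x·ξ} f x dx` (a unitary operator on `L²(ℝ²)`). It is a rescaling of
Mathlib's `𝓕`, whose kernel is `e^{-2πi x·ξ}`. -/
def hat (f : L2) (ξ : Plane) : ℂ :=
  ((2 * Real.pi)⁻¹ : ℝ) • (𝓕 f : L2) ((2 * Real.pi)⁻¹ • ξ)

/-! ### The Hilbert space `L²h¹(ℝ² × ℤ)` -/

/-- The Japanese bracket `⟨j⟩ = (1 + j²)^{1/2}`. -/
def bracket (j : ℤ) : ℝ := Real.sqrt (1 + (j : ℝ) ^ 2)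

theorem bracket_pos (j : ℤ) : 0 < bracket j := Real.sqrt_pos.2 (by positivity)

theorem weighted_memlp_iff (u : ℤ → L2) :
    Memℓp (fun j => (bracket j : ℂ) • u j) 2 ↔
      Summable fun j : ℤ => bracket j ^ 2 * ‖u j‖ ^ 2 := by
  rw [memℓp_gen_iff (by norm_num)]
  refine summable_congr fun j => ?_
  rw [norm_smul, Complex.norm_real, Real.norm_of_nonneg (bracket_pos j).le]
  simp [mul_pow]

/-- The sequences `(u_j)_{j ∈ ℤ}` in `L²(ℝ²)` with `∑ ⟨j⟩² ‖u_j‖² < ∞`. -/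
def seqSubmodule : Submodule ℂ (ℤ → L2) where
  carrier := {u | Summable fun j : ℤ => bracket j ^ 2 * ‖u j‖ ^ 2}
  zero_mem' := by simp
  add_mem' := by
    intro u v hu hv
    have hu' := (weighted_memlp_iff u).2 hu
    have hv' := (weighted_memlp_iff v).2 hv
    refine (weighted_memlp_iff (u + v)).1 ?_
    have := hu'.add hv'
    convert this using 1
    funext j
    simp
  smul_mem' := by
    intro c u hu
    have hu' := (weighted_memlp_iff u).2 hu
    refine (weighted_memlp_iff (c • u)).1 ?_
    have := hu'.const_smul c
    convert this using 1
    funext j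
    simp [smul_comm]

/-- The space `L²h¹(ℝ² × ℤ)`: sequences `(u_j)_{j ∈ ℤ}` in `L²(ℝ²)` with
`∑ ⟨j⟩² ‖u_j‖² < ∞`. -/
def L2h1 : Type := seqSubmodule

namespace L2h1

instance : AddCommGroup L2h1 := inferInstanceAs (AddCommGroup seqSubmodule)

instance : Module ℂ L2h1 := inferInstanceAs (Module ℂ seqSubmodule)

/-- The `j`-th component `u_j` of `u`. -/
def comp (u : L2h1) (j : ℤ) : L2 := u.1 j

theorem summable_comp (u : L2h1) : Summable fun j : ℤ => bracket j ^ 2 * ‖u.comp j‖ ^ 2 := u.2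

theorem ext_comp {u v : L2h1} (h : ∀ j, u.comp j = v.comp j) : u = v :=
  Subtype.ext (funext h)

/-- The linear embedding `(u_j) ↦ (⟨j⟩ u_j)` of `L²h¹` in `ℓ²(ℤ; L²)`. -/
def toLp : L2h1 →ₗ[ℂ] lp (fun _ : ℤ => L2) 2 where
  toFun u := ⟨fun j => (bracket j : ℂ) • u.comp j, (weighted_memlp_iff _).2 u.2⟩
  map_add' u v := lp.ext (funext fun j => smul_add (bracket j : ℂ) (u.comp j) (v.comp j))
  map_smul' c u := lp.ext (funext fun j => smul_comm (bracket j : ℂ) c (u.comp j))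

theorem toLp_apply (u : L2h1) (j : ℤ) : toLp u j = (bracket j : ℂ) • u.comp j := rfl

theorem toLp_injective : Function.Injective toLp := by
  intro u v h
  refine ext_comp fun j => ?_
  have hj : (bracket j : ℂ) • u.comp j = (bracket j : ℂ) • v.comp j := by
    rw [← toLp_apply, ← toLp_apply, h]
  exact smul_right_injective L2 (Complex.ofReal_ne_zero.2 (bracket_pos j).ne') hj

/-- The norm of `L²h¹`, see `norm_sq` for the explicit formula. -/
instance : NormedAddCommGroup L2h1 :=
  NormedAddCommGroup.induced L2h1 (lp (fun _ : ℤ => L2) 2) toLp toLp_injective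

instance : NormedSpace ℂ L2h1 := NormedSpace.induced ℂ L2h1 (lp (fun _ : ℤ => L2) 2) toLp

/-- `‖u‖² = ∑_j ⟨j⟩² ‖u_j‖²`. -/
theorem norm_sq (u : L2h1) : ‖u‖ ^ 2 = ∑' j : ℤ, bracket j ^ 2 * ‖u.comp j‖ ^ 2 := by
  have h : ‖u‖ = ‖toLp u‖ := rfl
  have h2 := lp.norm_rpow_eq_tsum (p := 2) (by norm_num) (toLp u)
  rw [h]
  have e : (2 : ℝ≥0∞).toReal = ((2 : ℕ) : ℝ) := by norm_num
  simp only [e, Real.rpow_natCast] at h2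
  rw [h2]
  refine tsum_congr fun j => ?_
  rw [toLp_apply, norm_smul, Complex.norm_real, Real.norm_of_nonneg (bracket_pos j).le, mul_pow]

/-- The norm is the `L²_x` norm of the `h¹` norm: `‖u‖² = ∫ ∑_j ⟨j⟩² |u_j(x)|² dx`. -/
theorem norm_sq_eq_lintegral (u : L2h1) :
    ENNReal.ofReal (‖u‖ ^ 2) =
      ∫⁻ x, ∑' j : ℤ, ENNReal.ofReal (bracket j ^ 2 * ‖u.comp j x‖ ^ 2) := by
  rw [lintegral_tsum fun j => ?_, norm_sq,
    ENNReal.ofReal_tsum_of_nonneg (fun j => by positivity) u.summable_comp]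
  · refine tsum_congr fun j => ?_
    have h1 : ‖u.comp j‖ ^ 2 = ∫ x, ‖u.comp j x‖ ^ 2 := by
      have h := L2.inner_def (𝕜 := ℂ) (u.comp j) (u.comp j)
      have h2 : ((‖u.comp j‖ ^ 2 : ℝ) : ℂ) = ((∫ x, ‖u.comp j x‖ ^ 2 : ℝ) : ℂ) := by
        rw [← integral_complex_ofReal]
        push_cast
        have h4 : ⟪u.comp j, u.comp j⟫_ℂ = ((‖u.comp j‖ : ℝ) : ℂ) ^ 2 :=
          inner_self_eq_norm_sq_to_K (𝕜 := ℂ) _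
        rw [← h4, h]
        refine integral_congr_ae (Eventually.of_forall fun x => ?_)
        exact inner_self_eq_norm_sq_to_K (𝕜 := ℂ) _
      exact_mod_cast h2
    have h3 : Integrable (fun x => ‖u.comp j x‖ ^ 2) volume :=
      (Lp.memLp (u.comp j)).integrable_norm_pow (by norm_num)
    rw [h1, ← integral_const_mul, ofReal_integral_eq_lintegral_ofReal (h3.const_mul _)]
    exact Eventually.of_forall fun x => by positivity
  · exact ((((Lp.stronglyMeasurable (u.comp j)).norm.measurable.pow_const 2).const_mul
      _).ennreal_ofReal).aemeasurable

end L2h1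

/-! ### The symmetry group -/

/-- `(g f)(x) = λ⁻¹ e^{iθ} e^{i x·ξ₀} f((x - x₀)/λ)`: the phase rotation by `θ`, the Galilean boost
by `ξ₀`, the translation by `x₀` and the dilation by `l = λ`, at a fixed time. -/
def symFun (θ : ℝ) (ξ₀ x₀ : Plane) (l : ℝ) (f : Plane → ℂ) (x : Plane) : ℂ :=
  (l⁻¹ : ℝ) * (Complex.exp (θ * Complex.I) * Complex.exp ((⟪x, ξ₀⟫_ℝ : ℝ) * Complex.I)) *
    f (l⁻¹ • (x - x₀))

theorem measurable_aff (x₀ : Plane) (l : ℝ) : Measurable fun x : Plane => l⁻¹ • (x - x₀) := by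
  fun_prop

theorem map_aff (x₀ : Plane) {l : ℝ} (hl : 0 < l) :
    Measure.map (fun x : Plane => l⁻¹ • (x - x₀)) volume =
      ENNReal.ofReal (l ^ 2) • (volume : Measure Plane) := by
  have h1 : Measure.map (fun x : Plane => x - x₀) volume = (volume : Measure Plane) :=
    (measurePreserving_sub_right volume x₀).map_eq
  have h2 := Measure.map_addHaar_smul (volume : Measure Plane) (inv_ne_zero hl.ne')
  have h3 : (fun x : Plane => l⁻¹ • (x - x₀)) =
      (fun x : Plane => l⁻¹ • x) ∘ (fun x : Plane => x - x₀) := rfl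
  rw [h3, ← Measure.map_map (by fun_prop) (by fun_prop), h1]
  refine h2.trans ?_
  congr 2
  simp only [finrank_euclideanSpace, Fintype.card_fin, inv_pow, inv_inv]
  exact abs_of_pos (by positivity)

theorem quasi_aff (x₀ : Plane) {l : ℝ} (hl : 0 < l) :
    Measure.QuasiMeasurePreserving (fun x : Plane => l⁻¹ • (x - x₀)) volume volume :=
  ⟨measurable_aff x₀ l, by rw [map_aff x₀ hl]; exact Measure.smul_absolutelyContinuous⟩

theorem symFun_congr (θ : ℝ) (ξ₀ x₀ : Plane) {l : ℝ} (hl : 0 < l) {f g : Plane → ℂ}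
    (h : f =ᵐ[volume] g) : symFun θ ξ₀ x₀ l f =ᵐ[volume] symFun θ ξ₀ x₀ l g := by
  filter_upwards [(quasi_aff x₀ hl).ae_eq h] with x hx
  simp only [Function.comp_apply] at hx
  simp only [symFun, hx]

theorem norm_symFun (θ : ℝ) (ξ₀ x₀ : Plane) (l : ℝ) (f : Plane → ℂ) (x : Plane) :
    ‖symFun θ ξ₀ x₀ l f x‖ = ‖l⁻¹ • f (l⁻¹ • (x - x₀))‖ := by
  simp only [symFun, norm_mul, Complex.norm_exp_ofReal_mul_I, norm_smul, Complex.norm_real, mul_one]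

theorem eLpNorm_symFun (θ : ℝ) (ξ₀ x₀ : Plane) {l : ℝ} (hl : 0 < l) {f : Plane → ℂ}
    (hf : AEStronglyMeasurable f volume) :
    eLpNorm (symFun θ ξ₀ x₀ l f) 2 volume = eLpNorm f 2 volume := by
  rw [eLpNorm_congr_norm_ae (Eventually.of_forall (norm_symFun θ ξ₀ x₀ l f))]
  have h1 : eLpNorm (fun x => l⁻¹ • f (l⁻¹ • (x - x₀))) 2 volume =
      ‖l⁻¹‖ₑ * eLpNorm (f ∘ fun x => l⁻¹ • (x - x₀)) 2 volume :=
    eLpNorm_const_smul l⁻¹ (f ∘ fun x => l⁻¹ • (x - x₀)) 2 volume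
  have h2 : eLpNorm (f ∘ fun x => l⁻¹ • (x - x₀)) 2 volume =
      ENNReal.ofReal l * eLpNorm f 2 volume := by
    rw [← eLpNorm_map_measure _ (measurable_aff x₀ l).aemeasurable, map_aff x₀ hl,
      eLpNorm_smul_measure_of_ne_top (by norm_num)]
    · rw [ENNReal.ofReal_rpow_of_pos (by positivity), smul_eq_mul]
      congr 2
      have : (1 / (2 : ℝ≥0∞)).toReal = (1 / 2 : ℝ) := by norm_num
      rw [this, ← Real.sqrt_eq_rpow, Real.sqrt_sq hl.le]
    · rw [map_aff x₀ hl]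
      exact hf.smul_measure _
  rw [h1, h2, ← mul_assoc, Real.enorm_of_nonneg (by positivity),
    ← ENNReal.ofReal_mul (by positivity), inv_mul_cancel₀ hl.ne', ENNReal.ofReal_one, one_mul]

theorem memLp_symFun (θ : ℝ) (ξ₀ x₀ : Plane) {l : ℝ} (hl : 0 < l) {f : Plane → ℂ}
    (hf : MemLp f 2 volume) : MemLp (symFun θ ξ₀ x₀ l f) 2 volume := by
  refine ⟨?_, ?_⟩
  · have h := hf.1.comp_quasiMeasurePreserving (quasi_aff x₀ hl)
    have h' : Continuous fun x : Plane => (l⁻¹ : ℝ) * (Complex.exp (θ * Complex.I) *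
        Complex.exp ((⟪x, ξ₀⟫_ℝ : ℝ) * Complex.I)) := by fun_prop
    exact h'.aestronglyMeasurable.mul h
  · rw [eLpNorm_symFun θ ξ₀ x₀ hl hf.1]
    exact hf.2

theorem symFun_one (f : Plane → ℂ) : symFun 0 0 0 1 f = f := by
  funext x
  simp [symFun]

theorem symFun_symFun (θ₁ θ₂ : ℝ) (ξ₁ ξ₂ x₁ x₂ : Plane) {l₁ l₂ : ℝ} (hl₁ : 0 < l₁) (hl₂ : 0 < l₂)
    (f : Plane → ℂ) :
    symFun θ₁ ξ₁ x₁ l₁ (symFun θ₂ ξ₂ x₂ l₂ f) =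
      symFun (θ₁ + θ₂ - l₁⁻¹ * ⟪x₁, ξ₂⟫_ℝ) (ξ₁ + l₁⁻¹ • ξ₂) (x₁ + l₁ • x₂) (l₁ * l₂) f := by
  funext x
  have harg : l₂⁻¹ • (l₁⁻¹ • (x - x₁) - x₂) = (l₁ * l₂)⁻¹ • (x - (x₁ + l₁ • x₂)) := by
    rw [smul_sub, smul_smul, ← sub_sub, smul_sub _ (x - x₁), smul_smul, mul_inv_rev]
    congr 2
    field_simp
  have hexp : Complex.exp (θ₁ * Complex.I) * Complex.exp ((⟪x, ξ₁⟫_ℝ : ℝ) * Complex.I) *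
      (Complex.exp (θ₂ * Complex.I) *
        Complex.exp ((⟪l₁⁻¹ • (x - x₁), ξ₂⟫_ℝ : ℝ) * Complex.I)) =
      Complex.exp (((θ₁ + θ₂ - l₁⁻¹ * ⟪x₁, ξ₂⟫_ℝ : ℝ) : ℂ) * Complex.I) *
        Complex.exp ((⟪x, ξ₁ + l₁⁻¹ • ξ₂⟫_ℝ : ℝ) * Complex.I) := by
    simp only [← Complex.exp_add]
    congr 1
    rw [real_inner_smul_left, inner_sub_left, inner_add_right, real_inner_smul_right]
    push_cast
    ring
  simp only [symFun]
  rw [harg, ← hexp]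
  push_cast
  rw [mul_inv]
  ring

/-- The symmetry `g_{θ,ξ₀,x₀,λ}` as a linear isometry of `L²(ℝ²)`. -/
def symL2 (θ : ℝ) (ξ₀ x₀ : Plane) (l : {r : ℝ // 0 < r}) : L2 →ₗᵢ[ℂ] L2 where
  toFun f := (memLp_symFun θ ξ₀ x₀ l.2 (Lp.memLp f)).toLp _
  map_add' f g := by
    refine Lp.ext ?_
    filter_upwards [(memLp_symFun θ ξ₀ x₀ l.2 (Lp.memLp (f + g))).coeFn_toLp,
      (memLp_symFun θ ξ₀ x₀ l.2 (Lp.memLp f)).coeFn_toLp,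
      (memLp_symFun θ ξ₀ x₀ l.2 (Lp.memLp g)).coeFn_toLp,
      Lp.coeFn_add ((memLp_symFun θ ξ₀ x₀ l.2 (Lp.memLp f)).toLp _)
        ((memLp_symFun θ ξ₀ x₀ l.2 (Lp.memLp g)).toLp _),
      symFun_congr θ ξ₀ x₀ l.2 (Lp.coeFn_add f g)] with x h1 h2 h3 h4 h5
    rw [h1, h4, h5, Pi.add_apply, h2, h3]
    simp only [symFun, Pi.add_apply]
    ring
  map_smul' c f := by
    refine Lp.ext ?_
    filter_upwards [(memLp_symFun θ ξ₀ x₀ l.2 (Lp.memLp (c • f))).coeFn_toLp,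
      (memLp_symFun θ ξ₀ x₀ l.2 (Lp.memLp f)).coeFn_toLp,
      Lp.coeFn_smul c ((memLp_symFun θ ξ₀ x₀ l.2 (Lp.memLp f)).toLp _),
      symFun_congr θ ξ₀ x₀ l.2 (Lp.coeFn_smul c f)] with x h1 h2 h4 h5
    rw [h1, RingHom.id_apply, h4, h5, Pi.smul_apply, h2]
    simp only [symFun, Pi.smul_apply, smul_eq_mul]
    ring
  norm_map' f := by
    change ‖(memLp_symFun θ ξ₀ x₀ l.2 (Lp.memLp f)).toLp _‖ = ‖f‖
    rw [Lp.norm_toLp, eLpNorm_symFun θ ξ₀ x₀ l.2 (Lp.memLp f).1, Lp.norm_def]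

theorem coeFn_symL2 (θ : ℝ) (ξ₀ x₀ : Plane) (l : {r : ℝ // 0 < r}) (f : L2) :
    symL2 θ ξ₀ x₀ l f =ᵐ[volume] symFun θ ξ₀ x₀ l f :=
  (memLp_symFun θ ξ₀ x₀ l.2 (Lp.memLp f)).coeFn_toLp

theorem symL2_one (f : L2) : symL2 0 0 0 ⟨1, one_pos⟩ f = f := by
  refine Lp.ext ?_
  have h := coeFn_symL2 0 0 0 ⟨1, one_pos⟩ f
  rwa [symFun_one] at h

theorem symL2_symL2 (θ₁ θ₂ : ℝ) (ξ₁ ξ₂ x₁ x₂ : Plane) (l₁ l₂ : {r : ℝ // 0 < r}) (f : L2) :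
    symL2 θ₁ ξ₁ x₁ l₁ (symL2 θ₂ ξ₂ x₂ l₂ f) =
      symL2 (θ₁ + θ₂ - l₁.1⁻¹ * ⟪x₁, ξ₂⟫_ℝ) (ξ₁ + l₁.1⁻¹ • ξ₂) (x₁ + l₁.1 • x₂)
        ⟨l₁.1 * l₂.1, mul_pos l₁.2 l₂.2⟩ f := by
  have h1 := coeFn_symL2 θ₁ ξ₁ x₁ l₁ (symL2 θ₂ ξ₂ x₂ l₂ f)
  have h2 := symFun_congr θ₁ ξ₁ x₁ l₁.2 (coeFn_symL2 θ₂ ξ₂ x₂ l₂ f)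
  have h3 := coeFn_symL2 (θ₁ + θ₂ - l₁.1⁻¹ * ⟪x₁, ξ₂⟫_ℝ) (ξ₁ + l₁.1⁻¹ • ξ₂) (x₁ + l₁.1 • x₂)
    ⟨l₁.1 * l₂.1, mul_pos l₁.2 l₂.2⟩ f
  have h4 := symFun_symFun θ₁ θ₂ ξ₁ ξ₂ x₁ x₂ l₁.2 l₂.2 f
  refine Lp.ext ?_
  filter_upwards [h1, h2, h3] with x e1 e2 e3
  rw [e1, e2, e3, h4]

/-- The symmetry `g_{θ,ξ₀,x₀,λ}`, acting on `L²h¹` in each component. -/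
def symMap (θ : ℝ) (ξ₀ x₀ : Plane) (l : {r : ℝ // 0 < r}) (u : L2h1) : L2h1 :=
  ⟨fun j => symL2 θ ξ₀ x₀ l (u.comp j), by
    have h := u.summable_comp
    change Summable fun j : ℤ => bracket j ^ 2 * ‖symL2 θ ξ₀ x₀ l (u.comp j)‖ ^ 2
    simpa only [LinearIsometry.norm_map] using h⟩

theorem comp_symMap (θ : ℝ) (ξ₀ x₀ : Plane) (l : {r : ℝ // 0 < r}) (u : L2h1) (j : ℤ) :
    (symMap θ ξ₀ x₀ l u).comp j = symL2 θ ξ₀ x₀ l (u.comp j) := rfl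

theorem symMap_one (u : L2h1) : symMap 0 0 0 ⟨1, one_pos⟩ u = u :=
  L2h1.ext_comp fun j => symL2_one (u.comp j)

theorem symMap_symMap (θ₁ θ₂ : ℝ) (ξ₁ ξ₂ x₁ x₂ : Plane) (l₁ l₂ : {r : ℝ // 0 < r}) (u : L2h1) :
    symMap θ₁ ξ₁ x₁ l₁ (symMap θ₂ ξ₂ x₂ l₂ u) =
      symMap (θ₁ + θ₂ - l₁.1⁻¹ * ⟪x₁, ξ₂⟫_ℝ) (ξ₁ + l₁.1⁻¹ • ξ₂) (x₁ + l₁.1 • x₂)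
        ⟨l₁.1 * l₂.1, mul_pos l₁.2 l₂.2⟩ u :=
  L2h1.ext_comp fun j => symL2_symL2 θ₁ θ₂ ξ₁ ξ₂ x₁ x₂ l₁ l₂ (u.comp j)

theorem symMap_inv_symMap (θ : ℝ) (ξ₀ x₀ : Plane) (l : {r : ℝ // 0 < r}) (u : L2h1) :
    symMap (-θ - ⟪x₀, ξ₀⟫_ℝ) (-(l.1 • ξ₀)) (-(l.1⁻¹ • x₀)) ⟨l.1⁻¹, inv_pos.2 l.2⟩
      (symMap θ ξ₀ x₀ l u) = u := by
  have hl : l.1 ≠ 0 := ne_of_gt l.2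
  rw [symMap_symMap]
  conv_rhs => rw [← symMap_one u]
  congr 1
  · simp only [inv_inv, inner_neg_left, real_inner_smul_left]
    field_simp
    ring
  · simp
  · simp
  · simp [hl]

theorem symMap_symMap_inv (θ : ℝ) (ξ₀ x₀ : Plane) (l : {r : ℝ // 0 < r}) (u : L2h1) :
    symMap θ ξ₀ x₀ l (symMap (-θ - ⟪x₀, ξ₀⟫_ℝ) (-(l.1 • ξ₀)) (-(l.1⁻¹ • x₀))
      ⟨l.1⁻¹, inv_pos.2 l.2⟩ u) = u := by
  have hl : l.1 ≠ 0 := ne_of_gt l.2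
  rw [symMap_symMap]
  conv_rhs => rw [← symMap_one u]
  congr 1
  · simp only [inner_neg_right, real_inner_smul_right]
    field_simp
    ring
  · simp [smul_smul, hl]
  · simp [smul_smul, hl]
  · simp [hl]

/-- The symmetry `g_{θ,ξ₀,x₀,λ}` as a unitary operator on `L²h¹`. -/
def sym (θ : ℝ) (ξ₀ x₀ : Plane) (l : {r : ℝ // 0 < r}) : L2h1 ≃ₗᵢ[ℂ] L2h1 where
  toFun := symMap θ ξ₀ x₀ l
  invFun := symMap (-θ - ⟪x₀, ξ₀⟫_ℝ) (-(l.1 • ξ₀)) (-(l.1⁻¹ • x₀)) ⟨l.1⁻¹, inv_pos.2 l.2⟩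
  left_inv := symMap_inv_symMap θ ξ₀ x₀ l
  right_inv := symMap_symMap_inv θ ξ₀ x₀ l
  map_add' u v := L2h1.ext_comp fun j => (symL2 θ ξ₀ x₀ l).map_add (u.comp j) (v.comp j)
  map_smul' c u := L2h1.ext_comp fun j => (symL2 θ ξ₀ x₀ l).map_smul c (u.comp j)
  norm_map' u := by
    change ‖symMap θ ξ₀ x₀ l u‖ = ‖u‖
    rw [← sq_eq_sq₀ (norm_nonneg _) (norm_nonneg _), L2h1.norm_sq, L2h1.norm_sq]
    simp only [comp_symMap, LinearIsometry.norm_map]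

theorem sym_apply (θ : ℝ) (ξ₀ x₀ : Plane) (l : {r : ℝ // 0 < r}) (u : L2h1) :
    sym θ ξ₀ x₀ l u = symMap θ ξ₀ x₀ l u := rfl

/-- The group `G` generated by phase rotations, Galilean transforms, translations and dilations.
Its elements are exactly the operators `g_{θ,ξ₀,x₀,λ}`. -/
def G : Subgroup (L2h1 ≃ₗᵢ[ℂ] L2h1) where
  carrier := {g | ∃ (θ : ℝ) (ξ₀ x₀ : Plane) (l : {r : ℝ // 0 < r}), g = sym θ ξ₀ x₀ l}
  mul_mem' := by
    rintro _ _ ⟨θ₁, ξ₁, x₁, l₁, rfl⟩ ⟨θ₂, ξ₂, x₂, l₂, rfl⟩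
    exact ⟨_, _, _, _, LinearIsometryEquiv.ext fun u =>
      symMap_symMap θ₁ θ₂ ξ₁ ξ₂ x₁ x₂ l₁ l₂ u⟩
  one_mem' := ⟨0, 0, 0, ⟨1, one_pos⟩, LinearIsometryEquiv.ext fun u => (symMap_one u).symm⟩
  inv_mem' := by
    rintro _ ⟨θ, ξ₀, x₀, l, rfl⟩
    exact ⟨_, _, _, _, LinearIsometryEquiv.ext fun u => rfl⟩

/-- `G` acts on `L²h¹` by evaluation. -/
instance : MulAction G L2h1 where
  smul g u := (g : L2h1 ≃ₗᵢ[ℂ] L2h1) u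
  one_smul _ := rfl
  mul_smul _ _ _ := rfl

/-- The space `G \ L²h¹` of `G`-orbits, with the quotient topology. -/
abbrev Orbits : Type := Quotient (MulAction.orbitRel G L2h1)

/-- The orbit `G u`, as a point of `G \ L²h¹`. -/
def orbit (u : L2h1) : Orbits := Quotient.mk (MulAction.orbitRel G L2h1) u

/-- A set is precompact if its closure is compact. -/
def IsPrecompact {X : Type*} [TopologicalSpace X] (S : Set X) : Prop := IsCompact (closure S)

/-- `u : I → L²h¹` is almost periodic modulo `G` if its quotiented orbit `{G u(t) : t ∈ I}` is a
precompact subset of `G \ L²h¹`. -/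
def IsAlmostPeriodicModG (I : Set ℝ) (u : ℝ → L2h1) : Prop :=
  IsPrecompact {p : Orbits | ∃ t ∈ I, p = orbit (u t)}

/-! ### The quantitative bounds -/

/-- `∑_{|j| > K} ⟨j⟩² ‖u_j‖²`. -/
def tailMass (K : ℕ) (u : L2h1) : ℝ :=
  ∑' j : {j : ℤ // (K : ℤ) < |j|}, bracket j ^ 2 * ‖u.comp j‖ ^ 2

/-- `∑_{|j| ≤ K} ⟨j⟩² ∫_{|x - x₀| ≥ r} |u_j(x)|² dx`. -/
def spaceMass (K : ℕ) (x₀ : Plane) (r : ℝ) (u : L2h1) : ℝ :=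
  ∑ j ∈ Finset.Icc (-(K : ℤ)) K,
    bracket j ^ 2 * ∫ x in {x : Plane | r ≤ ‖x - x₀‖}, ‖u.comp j x‖ ^ 2

/-- `∑_{|j| ≤ K} ⟨j⟩² ∫_{|ξ - ξ₀| ≥ r} |û_j(ξ)|² dξ`. -/
def freqMass (K : ℕ) (ξ₀ : Plane) (r : ℝ) (u : L2h1) : ℝ :=
  ∑ j ∈ Finset.Icc (-(K : ℤ)) K,
    bracket j ^ 2 * ∫ ξ in {ξ : Plane | r ≤ ‖ξ - ξ₀‖}, ‖hat (u.comp j) ξ‖ ^ 2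

end ResonantNLS

end

/-! Statements 1 and 2 are the same by definition; the content is the equivalence with 3.

From 3 to 1, move each `u t` by the symmetry that carries `x t` and `ξ t` to the origin and the
scale `N t` to 1. The orbit does not change, and the new functions have uniformly small mass at high
modes and outside fixed balls in space and frequency. Such a set is totally bounded
(`totallyBounded_of_mass_lt`): localising to a ball in space, then to a ball in frequency, is a
compact operator on `L2` (`isCompactOperator_loc`), and on finitely many modes it approximates the
identity uniformly over the set. No bound on the norms is assumed; it comes from the uncertainty
principle `exists_norm_le_cut_ext`, by which the masses outside the two balls control the whole
norm. Completeness of `L2h1` and regularity of the orbit space turn total boundedness into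
precompactness of the orbits.

From 1 to 3, the parameters must be chosen once, before `η`. For every `u`, `normalizer u` is a
symmetry that puts most of `u` and of its Fourier transform in a ball of the smallest possible
integer radius. If some translate of `u` is close to `f ≠ 0`, minimality bounds this radius in terms
of `f`; hence the symmetry carrying `f` close to `normalizer u • u` has bounded parameters
(`exists_param_bound`, in space and in frequency), and `normalizer u • u` inherits the concentration
of `f`. This gives uniform bounds near each orbit (`exists_nhds_normalizer_lt`), and a finite
subcover of the compact closure makes them uniform in `t`. -/

noncomputable section

namespace ResonantNLS

/-! ### Restriction of `L²` functions to measurable sets -/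

theorem norm_sq_eq_integral (f : L2) : ‖f‖ ^ 2 = ∫ x, ‖f x‖ ^ 2 := by
  have h := L2.inner_def (𝕜 := ℂ) f f
  have h2 : ((‖f‖ ^ 2 : ℝ) : ℂ) = ((∫ x, ‖f x‖ ^ 2 : ℝ) : ℂ) := by
    rw [← integral_complex_ofReal]
    push_cast
    have h4 : ⟪f, f⟫_ℂ = ((‖f‖ : ℝ) : ℂ) ^ 2 := inner_self_eq_norm_sq_to_K (𝕜 := ℂ) _
    rw [← h4, h]
    exact integral_congr_ae (Eventually.of_forall fun x => inner_self_eq_norm_sq_to_K (𝕜 := ℂ) _)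
  exact_mod_cast h2

/-- Multiplication by the indicator function of a measurable set, as a linear map. -/
def cutLin {A : Set Plane} (hA : MeasurableSet A) : L2 →ₗ[ℂ] L2 where
  toFun f := ((Lp.memLp f).indicator hA).toLp _
  map_add' f g := by
    refine Lp.ext ?_
    filter_upwards [((Lp.memLp (f + g)).indicator hA).coeFn_toLp,
      ((Lp.memLp f).indicator hA).coeFn_toLp, ((Lp.memLp g).indicator hA).coeFn_toLp,
      Lp.coeFn_add (((Lp.memLp f).indicator hA).toLp _) (((Lp.memLp g).indicator hA).toLp _),
      Lp.coeFn_add f g] with x h1 h2 h3 h4 h5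
    rw [h1, h4, Pi.add_apply, h2, h3]
    by_cases hx : x ∈ A
    · simp only [Set.indicator_of_mem hx, h5, Pi.add_apply]
    · simp only [Set.indicator_of_notMem hx, add_zero]
  map_smul' c f := by
    refine Lp.ext ?_
    filter_upwards [((Lp.memLp (c • f)).indicator hA).coeFn_toLp,
      ((Lp.memLp f).indicator hA).coeFn_toLp,
      Lp.coeFn_smul c (((Lp.memLp f).indicator hA).toLp _),
      Lp.coeFn_smul c f] with x h1 h2 h4 h5
    rw [h1, RingHom.id_apply, h4, Pi.smul_apply, h2]
    by_cases hx : x ∈ A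
    · simp only [Set.indicator_of_mem hx, h5, Pi.smul_apply]
    · simp only [Set.indicator_of_notMem hx, smul_zero]

theorem coeFn_cutLin {A : Set Plane} (hA : MeasurableSet A) (f : L2) :
    cutLin hA f =ᵐ[volume] A.indicator f :=
  ((Lp.memLp f).indicator hA).coeFn_toLp

theorem norm_cutLin {A : Set Plane} (hA : MeasurableSet A) (f : L2) :
    ‖cutLin hA f‖ = (eLpNorm (A.indicator f) 2 volume).toReal := by
  rw [Lp.norm_def, eLpNorm_congr_ae (coeFn_cutLin hA f)]

theorem norm_cutLin_le {A : Set Plane} (hA : MeasurableSet A) (f : L2) :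
    ‖cutLin hA f‖ ≤ 1 * ‖f‖ := by
  rw [norm_cutLin, Lp.norm_def, one_mul]
  exact ENNReal.toReal_mono (Lp.eLpNorm_ne_top f) (eLpNorm_indicator_le _)

/-- Multiplication by the indicator function of a measurable set. -/
def cut {A : Set Plane} (hA : MeasurableSet A) : L2 →L[ℂ] L2 :=
  (cutLin hA).mkContinuous 1 (norm_cutLin_le hA)

theorem coeFn_cut {A : Set Plane} (hA : MeasurableSet A) (f : L2) :
    cut hA f =ᵐ[volume] A.indicator f :=
  coeFn_cutLin hA f

theorem norm_cut {A : Set Plane} (hA : MeasurableSet A) (f : L2) :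
    ‖cut hA f‖ = (eLpNorm (A.indicator f) 2 volume).toReal :=
  norm_cutLin hA f

theorem norm_cut_le {A : Set Plane} (hA : MeasurableSet A) (f : L2) : ‖cut hA f‖ ≤ ‖f‖ :=
  (norm_cutLin_le hA f).trans_eq (one_mul _)

theorem norm_cut_sq {A : Set Plane} (hA : MeasurableSet A) (f : L2) :
    ‖cut hA f‖ ^ 2 = ∫ x in A, ‖f x‖ ^ 2 := by
  rw [norm_sq_eq_integral, ← integral_indicator hA]
  refine integral_congr_ae ?_
  filter_upwards [coeFn_cut hA f] with x hx
  by_cases h : x ∈ A <;> simp [hx, h]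

theorem norm_cut_mono {A B : Set Plane} (hA : MeasurableSet A) (hB : MeasurableSet B)
    (h : A ⊆ B) (f : L2) : ‖cut hA f‖ ≤ ‖cut hB f‖ := by
  rw [norm_cut, norm_cut]
  refine ENNReal.toReal_mono ((Lp.memLp f).indicator hB).2.ne (eLpNorm_mono fun x => ?_)
  by_cases hx : x ∈ A
  · simp [hx, h hx]
  · simp [hx]

theorem cut_add_cut_compl {A : Set Plane} (hA : MeasurableSet A) (f : L2) :
    cut hA f + cut hA.compl f = f := by
  refine Lp.ext ?_
  filter_upwards [Lp.coeFn_add (cut hA f) (cut hA.compl f), coeFn_cut hA f,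
    coeFn_cut hA.compl f] with x h1 h2 h3
  rw [h1, Pi.add_apply, h2, h3]
  by_cases hx : x ∈ A <;> simp [hx]

theorem norm_sq_eq_cut_add {A : Set Plane} (hA : MeasurableSet A) (f : L2) :
    ‖f‖ ^ 2 = ‖cut hA f‖ ^ 2 + ‖cut hA.compl f‖ ^ 2 := by
  rw [norm_cut_sq, norm_cut_sq, norm_sq_eq_integral,
    integral_add_compl hA ((Lp.memLp f).integrable_norm_pow (by norm_num))]

/-- The change of variables behind all later comparisons of masses: cutting after a symmetry costs
the same as cutting before it on the pulled-back set. -/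
theorem norm_cut_symL2 {A B : Set Plane} (hA : MeasurableSet A) (hB : MeasurableSet B)
    (θ : ℝ) (ξ₀ x₀ : Plane) (l : {r : ℝ // 0 < r})
    (h : ∀ x, x ∈ A ↔ l.1⁻¹ • (x - x₀) ∈ B) (f : L2) :
    ‖cut hA (symL2 θ ξ₀ x₀ l f)‖ = ‖cut hB f‖ := by
  rw [norm_cut, norm_cut, ← eLpNorm_symFun θ ξ₀ x₀ l.2 ((Lp.memLp f).indicator hB).1]
  congr 1
  refine eLpNorm_congr_ae ?_
  filter_upwards [coeFn_symL2 θ ξ₀ x₀ l f] with x hx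
  by_cases hxA : x ∈ A
  · simp [hxA, (h x).1 hxA, hx, symFun]
  · have hxB : l.1⁻¹ • (x - x₀) ∉ B := fun hB' => hxA ((h x).2 hB')
    simp only [Set.indicator_of_notMem hxA, symFun, Set.indicator_of_notMem hxB, mul_zero]

/-- Absolute continuity of the integral; it will exclude concentration on tiny balls, that is,
strong dilations. -/
theorem exists_norm_cut_le (f : L2) {ε : ℝ} (hε : 0 < ε) :
    ∃ δ : ℝ, 0 < δ ∧ ∀ (A : Set Plane) (hA : MeasurableSet A),
      volume A ≤ ENNReal.ofReal δ → ‖cut hA f‖ ≤ ε := by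
  obtain ⟨δ, hδ, h⟩ := (Lp.memLp f).eLpNorm_indicator_le (by norm_num) (by norm_num) hε
  refine ⟨δ, hδ, fun A hA hv => ?_⟩
  rw [norm_cut]
  exact ENNReal.toReal_le_of_le_ofReal hε.le (h A hA hv)

/-- The exterior of the ball of radius `r` about the origin. -/
def ext (r : ℝ) : Set Plane := {x | r ≤ ‖x‖}

theorem measurableSet_ext (r : ℝ) : MeasurableSet (ext r) :=
  (isClosed_le continuous_const continuous_norm).measurableSet

theorem tendsto_cut_ext (f : L2) :
    Tendsto (fun r : ℝ => cut (measurableSet_ext r) f) atTop (𝓝 0) := by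
  have h : Tendsto (fun r : ℝ => ∫ x, (ext r).indicator (fun x => ‖f x‖ ^ 2) x) atTop
      (𝓝 (∫ _ : Plane, (0 : ℝ))) := by
    refine tendsto_integral_filter_of_dominated_convergence (fun x => ‖f x‖ ^ 2)
      (Eventually.of_forall fun r => ?_) (Eventually.of_forall fun r => ?_)
      ((Lp.memLp f).integrable_norm_pow (by norm_num)) (Eventually.of_forall fun x => ?_)
    · exact (((Lp.memLp f).1.norm.pow 2)).indicator (measurableSet_ext r)
    · refine Eventually.of_forall fun x => ?_
      by_cases hx : x ∈ ext r <;> simp [hx]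
    · refine tendsto_const_nhds.congr' ?_
      filter_upwards [eventually_gt_atTop ‖x‖] with r hr
      simp [ext, hr]
  rw [integral_zero] at h
  rw [tendsto_zero_iff_norm_tendsto_zero]
  have h2 := (Real.continuous_sqrt.tendsto 0).comp h
  rw [Real.sqrt_zero] at h2
  refine h2.congr fun r => ?_
  rw [Function.comp_apply, integral_indicator (measurableSet_ext r), ← norm_cut_sq,
    Real.sqrt_sq (norm_nonneg _)]

/-! ### The Fourier transform on `L²` -/

theorem continuous_fourier_of_integrable {f : Plane → ℂ} (hf : Integrable f) :
    Continuous (𝓕 f : Plane → ℂ) :=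
  VectorFourier.fourierIntegral_continuous Real.continuous_fourierChar
    (by exact continuous_inner) hf

/-- The Fourier transform on `L²` is given by the Fourier integral on `L¹ ∩ L²`. -/
theorem coeFn_fourier_toLp {f : Plane → ℂ} (hf : Integrable f) (hf2 : MemLp f 2 volume) :
    (𝓕 (hf2.toLp f) : L2) =ᵐ[volume] (𝓕 f : Plane → ℂ) := by
  -- Both sides are tested against a smooth compactly supported `g`. The transform passes to `g` on
  -- the left by the definition for tempered distributions, on the right by Fubini.
  refine ae_eq_of_integral_contDiff_smul_eq ((Lp.memLp _).locallyIntegrable (by norm_num))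
    (continuous_fourier_of_integrable hf).locallyIntegrable fun g hg hgc => ?_
  have hg₁ : HasCompactSupport (Complex.ofRealCLM ∘ g) := hgc.comp_left rfl
  have hg₂ : ContDiff ℝ ((⊤ : ℕ∞) : WithTop ℕ∞) (Complex.ofRealCLM ∘ g) := by fun_prop
  set γ : SchwartzMap Plane ℂ := hg₁.toSchwartzMap hg₂ with hγ
  have hγg : ∀ x, γ x = (g x : ℂ) := fun x => rfl
  have h1 : ∫ x, g x • (𝓕 (hf2.toLp f) : L2) x =
      (Lp.toTemperedDistribution (𝓕 (hf2.toLp f) : L2)) γ := by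
    rw [Lp.toTemperedDistribution_apply]
    rfl
  rw [h1, ← Lp.fourier_toTemperedDistribution_eq, TemperedDistribution.fourier_apply,
    Lp.toTemperedDistribution_apply]
  have h2 : ∫ x, (𝓕 γ) x • (hf2.toLp f) x = ∫ x, (𝓕 γ) x • f x := by
    refine integral_congr_ae ?_
    filter_upwards [hf2.coeFn_toLp] with x hx
    rw [hx]
  rw [h2]
  have h3 := VectorFourier.integral_fourierIntegral_smul_eq_flip (μ := volume) (ν := volume)
    (L := innerₗ Plane) (f := (γ : Plane → ℂ)) (g := f) Real.continuous_fourierChar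
    (by exact continuous_inner) γ.integrable hf
  rw [flip_innerₗ] at h3
  exact h3

theorem two_pi_pos : 0 < 2 * Real.pi := by positivity

/-- The Fourier transform `f ↦ f̂` as a linear isometry of `L²(ℝ²)`. -/
def hatL : L2 →ₗᵢ[ℂ] L2 :=
  (symL2 0 0 0 ⟨2 * Real.pi, two_pi_pos⟩).comp
    (Lp.fourierTransformₗᵢ Plane ℂ).toLinearIsometry

theorem hatL_apply (f : L2) :
    hatL f = symL2 0 0 0 ⟨2 * Real.pi, two_pi_pos⟩ (𝓕 f : L2) := rfl

theorem coeFn_hatL (f : L2) : hatL f =ᵐ[volume] hat f := by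
  filter_upwards [coeFn_symL2 0 0 0 ⟨2 * Real.pi, two_pi_pos⟩ (𝓕 f : L2)] with x hx
  rw [hatL_apply, hx]
  simp [symFun, hat]

theorem integral_comp_aff (x₀ : Plane) (l : ℝ) (F : Plane → ℂ) :
    ∫ x, F (l⁻¹ • (x - x₀)) = (l ^ 2 : ℝ) • ∫ y, F y := by
  rw [integral_sub_right_eq_self (fun x => F (l⁻¹ • x)) x₀, Measure.integral_comp_inv_smul]
  simp

theorem fourier_symFun (θ : ℝ) (ξ₀ x₀ : Plane) {l : ℝ} (hl : 0 < l) (f : Plane → ℂ) (η : Plane) :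
    (𝓕 (symFun θ ξ₀ x₀ l f) : Plane → ℂ) η =
      l * Complex.exp ((θ + ⟪x₀, ξ₀⟫_ℝ - 2 * Real.pi * ⟪x₀, η⟫_ℝ : ℝ) * Complex.I) *
        (𝓕 f : Plane → ℂ) (l • (η - (2 * Real.pi)⁻¹ • ξ₀)) := by
  have hl' : (l : ℂ) ≠ 0 := Complex.ofReal_ne_zero.2 hl.ne'
  have hpi : (Real.pi : ℂ) ≠ 0 := Complex.ofReal_ne_zero.2 Real.pi_ne_zero
  rw [Real.fourier_eq', Real.fourier_eq']
  set F : Plane → ℂ := fun y =>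
    (l⁻¹ : ℝ) * (Complex.exp ((θ + ⟪x₀, ξ₀⟫_ℝ - 2 * Real.pi * ⟪x₀, η⟫_ℝ : ℝ) * Complex.I) *
      (Complex.exp ((-2 * Real.pi * ⟪y, l • (η - (2 * Real.pi)⁻¹ • ξ₀)⟫_ℝ : ℝ) * Complex.I) • f y))
    with hF
  have h1 : ∀ x, Complex.exp ((-2 * Real.pi * ⟪x, η⟫_ℝ : ℝ) * Complex.I) •
      symFun θ ξ₀ x₀ l f x = F (l⁻¹ • (x - x₀)) := by
    intro x
    have he : Complex.exp ((-2 * Real.pi * ⟪x, η⟫_ℝ : ℝ) * Complex.I) *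
        (Complex.exp (θ * Complex.I) * Complex.exp ((⟪x, ξ₀⟫_ℝ : ℝ) * Complex.I)) =
        Complex.exp ((θ + ⟪x₀, ξ₀⟫_ℝ - 2 * Real.pi * ⟪x₀, η⟫_ℝ : ℝ) * Complex.I) *
        Complex.exp ((-2 * Real.pi * ⟪l⁻¹ • (x - x₀), l • (η - (2 * Real.pi)⁻¹ • ξ₀)⟫_ℝ : ℝ) *
          Complex.I) := by
      rw [← Complex.exp_add, ← Complex.exp_add, ← Complex.exp_add]
      congr 1
      rw [real_inner_smul_left, real_inner_smul_right, inner_sub_right, inner_sub_left,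
        inner_sub_left, real_inner_smul_right, real_inner_smul_right]
      push_cast
      field_simp
      ring
    simp only [hF, symFun, smul_eq_mul]
    linear_combination ((l⁻¹ : ℝ) : ℂ) * f (l⁻¹ • (x - x₀)) * he
  simp_rw [h1]
  rw [integral_comp_aff x₀ l F, hF, integral_const_mul, integral_const_mul]
  simp only [Complex.real_smul]
  push_cast
  field_simp

theorem integrable_symFun (θ : ℝ) (ξ₀ x₀ : Plane) {l : ℝ} (hl : 0 < l) {f : Plane → ℂ}
    (hf : Integrable f) : Integrable (symFun θ ξ₀ x₀ l f) := by
  have h1 : Integrable fun x => f (l⁻¹ • (x - x₀)) :=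
    (hf.comp_smul (inv_ne_zero hl.ne')).comp_sub_right x₀
  have h' : Continuous fun x : Plane => (l⁻¹ : ℝ) * (Complex.exp (θ * Complex.I) *
      Complex.exp ((⟪x, ξ₀⟫_ℝ : ℝ) * Complex.I)) := by fun_prop
  refine h1.bdd_mul (c := ‖(l⁻¹ : ℝ)‖) h'.aestronglyMeasurable (Eventually.of_forall fun x => ?_)
  rw [norm_mul, norm_mul, Complex.norm_exp_ofReal_mul_I, Complex.norm_exp_ofReal_mul_I,
    Complex.norm_real, mul_one, mul_one]

/-- The Fourier transform intertwines the symmetries: translations become modulations and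
conversely, and dilations become inverse dilations. -/
theorem hatL_symL2 (θ : ℝ) (ξ₀ x₀ : Plane) (l : {r : ℝ // 0 < r}) (f : L2) :
    hatL (symL2 θ ξ₀ x₀ l f) =
      symL2 (θ + ⟪x₀, ξ₀⟫_ℝ) (-x₀) ξ₀ ⟨l.1⁻¹, inv_pos.2 l.2⟩ (hatL f) := by
  -- Both sides are continuous in `f`, so Schwartz functions suffice; for these the transform is an
  -- integral and `fourier_symFun` applies.
  refine DenseRange.induction_on
    (p := fun f : L2 => hatL (symL2 θ ξ₀ x₀ l f) =
      symL2 (θ + ⟪x₀, ξ₀⟫_ℝ) (-x₀) ξ₀ ⟨l.1⁻¹, inv_pos.2 l.2⟩ (hatL f))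
    (SchwartzMap.denseRange_toLpCLM (p := 2) (E := Plane) (F := ℂ) (μ := volume)
      (by norm_num)) f ?_ fun φ => ?_
  · exact isClosed_eq (hatL.continuous.comp (symL2 θ ξ₀ x₀ l).continuous)
      ((symL2 _ _ _ _).continuous.comp hatL.continuous)
  have hφ2 : MemLp φ 2 volume := φ.memLp 2
  have hs := memLp_symFun θ ξ₀ x₀ l.2 hφ2
  have hφ : SchwartzMap.toLpCLM ℝ ℂ 2 volume φ = hφ2.toLp φ := rfl
  rw [hφ]
  have e1 : symL2 θ ξ₀ x₀ l (hφ2.toLp φ) = hs.toLp _ := by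
    refine Lp.ext ?_
    exact (coeFn_symL2 θ ξ₀ x₀ l _).trans
      ((symFun_congr θ ξ₀ x₀ l.2 hφ2.coeFn_toLp).trans hs.coeFn_toLp.symm)
  rw [e1, hatL_apply, hatL_apply]
  refine Lp.ext ?_
  refine (coeFn_symL2 _ _ _ _ _).trans ?_
  refine (symFun_congr _ _ _ two_pi_pos
    (coeFn_fourier_toLp (integrable_symFun θ ξ₀ x₀ l.2 φ.integrable) hs)).trans ?_
  refine EventuallyEq.symm ?_
  rw [symL2_symL2]
  refine (coeFn_symL2 _ _ _ _ _).trans ?_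
  refine (symFun_congr _ _ _ (mul_pos (inv_pos.2 l.2) two_pi_pos)
    (coeFn_fourier_toLp φ.integrable hφ2)).trans (Eventually.of_forall fun ξ => ?_)
  have hl := l.2
  have hl0 : (l.1 : ℂ) ≠ 0 := Complex.ofReal_ne_zero.2 hl.ne'
  have hpi : (Real.pi : ℂ) ≠ 0 := Complex.ofReal_ne_zero.2 Real.pi_ne_zero
  simp only [symFun]
  rw [fourier_symFun θ ξ₀ x₀ l.2]
  have ha : (l.1⁻¹ * (2 * Real.pi))⁻¹ • (ξ - (ξ₀ + l.1⁻¹ • (0 : Plane))) =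
      l.1 • ((2 * Real.pi)⁻¹ • (ξ - 0) - (2 * Real.pi)⁻¹ • ξ₀) := by
    rw [smul_zero, add_zero, sub_zero, ← smul_sub, smul_smul]
    congr 1
    rw [mul_inv, inv_inv]
  rw [ha]
  have he : Complex.exp (((θ + ⟪x₀, ξ₀⟫_ℝ + 0 - l.1⁻¹⁻¹ * ⟪ξ₀, (0 : Plane)⟫_ℝ : ℝ) : ℂ) *
        Complex.I) *
      Complex.exp ((⟪ξ, -x₀ + l.1⁻¹⁻¹ • (0 : Plane)⟫_ℝ : ℝ) * Complex.I) =
      Complex.exp ((θ + ⟪x₀, ξ₀⟫_ℝ - 2 * Real.pi * ⟪x₀, (2 * Real.pi)⁻¹ • (ξ - 0)⟫_ℝ : ℝ) *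
        Complex.I) := by
    rw [← Complex.exp_add]
    congr 1
    rw [inner_zero_right, smul_zero, add_zero, add_zero, inner_neg_right, sub_zero,
      real_inner_smul_right, real_inner_comm x₀ ξ]
    push_cast
    field_simp
    ring
  rw [he]
  simp only [inner_zero_right, Complex.ofReal_zero, zero_mul, Complex.exp_zero, mul_inv, inv_inv]
  push_cast
  ring

/-! ### Compactness of space-frequency localisation -/

theorem measure_ext_compl_ne_top (r : ℝ) : volume (ext r)ᶜ ≠ ∞ := by
  have h : (ext r)ᶜ ⊆ Metric.closedBall 0 r := fun x hx => by
    rw [mem_closedBall_zero_iff]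
    exact (not_le.1 (show ¬ r ≤ ‖x‖ from hx)).le
  exact ((measure_mono h).trans_lt measure_closedBall_lt_top).ne

/-- Bounded sequences of `L²` have weakly convergent subsequences. -/
theorem exists_weakly_convergent_subseq (f : ℕ → L2) (hf : ∀ n, ‖f n‖ ≤ 1) :
    ∃ g : L2, ‖g‖ ≤ 1 ∧ ∃ φ : ℕ → ℕ, StrictMono φ ∧
      ∀ e : L2, Tendsto (fun n => ⟪f (φ n), e⟫_ℂ) atTop (𝓝 ⟪g, e⟫_ℂ) := by
  have : Fact ((2 : ℝ≥0∞) ≠ ∞) := ⟨by norm_num⟩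
  have hc := WeakDual.isSeqCompact_closedBall ℂ L2 (0 : StrongDual ℂ L2) 1
  obtain ⟨ψ, hψ, φ, hφ, hlim⟩ := hc
    (x := fun n => StrongDual.toWeakDual (InnerProductSpace.toDual ℂ L2 (f n))) (fun n => by
      simpa using hf n)
  refine ⟨(InnerProductSpace.toDual ℂ L2).symm (WeakDual.toStrongDual ψ), ?_, φ, hφ, fun e => ?_⟩
  · simpa using hψ
  · have := tendsto_iff_forall_eval_tendsto_topDualPairing.1 hlim e
    have hψe : ⟪(InnerProductSpace.toDual ℂ L2).symm (WeakDual.toStrongDual ψ), e⟫_ℂ = ψ e :=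
      InnerProductSpace.toDual_symm_apply
    rw [hψe]
    exact this

/-- The character `v ↦ e^{2πi v·w}` truncated to a set of finite measure. -/
def truncChar (A : Set Plane) (w : Plane) : Plane → ℂ :=
  A.indicator fun v => Complex.exp ((2 * Real.pi * ⟪v, w⟫_ℝ : ℝ) * Complex.I)

theorem norm_truncChar (A : Set Plane) (w v : Plane) :
    ‖truncChar A w v‖ = ‖A.indicator (fun _ => (1 : ℂ)) v‖ := by
  by_cases hv : v ∈ A
  · simp only [truncChar, Set.indicator_of_mem hv, Complex.norm_exp_ofReal_mul_I, norm_one]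
  · simp only [truncChar, Set.indicator_of_notMem hv]

theorem memLp_truncChar {A : Set Plane} (hA : MeasurableSet A) (hv : volume A ≠ ∞) (w : Plane) :
    MemLp (truncChar A w) 2 volume := by
  refine (memLp_indicator_const 2 hA (1 : ℂ) (Or.inr hv)).of_le ?_
    (Eventually.of_forall fun v => (norm_truncChar A w v).le)
  have h : Continuous fun v : Plane =>
      Complex.exp ((2 * Real.pi * ⟪v, w⟫_ℝ : ℝ) * Complex.I) := by fun_prop
  exact h.aestronglyMeasurable.indicator hA

theorem integrable_indicator_of_L2 {A : Set Plane} (hA : MeasurableSet A) (hv : volume A ≠ ∞)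
    (f : L2) : Integrable (A.indicator f) := by
  rw [integrable_indicator_iff hA]
  have : IsFiniteMeasure (volume.restrict A) := ⟨by simpa using hv.lt_top⟩
  exact ((Lp.memLp f).restrict A).integrable (by norm_num)

/-- On a set of finite measure the characters are square integrable, so point values of the
transform are weakly continuous functionals of `f`. -/
theorem fourier_indicator_eq_inner {A : Set Plane} (hA : MeasurableSet A) (hv : volume A ≠ ∞)
    (f : L2) (w : Plane) :
    (𝓕 (A.indicator f) : Plane → ℂ) w = ⟪(memLp_truncChar hA hv w).toLp _, f⟫_ℂ := by
  rw [L2.inner_def, Real.fourier_eq']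
  refine integral_congr_ae ?_
  filter_upwards [(memLp_truncChar hA hv w).coeFn_toLp] with v hv'
  rw [hv']
  by_cases h : v ∈ A
  · simp only [truncChar, Set.indicator_of_mem h, RCLike.inner_apply, ← Complex.exp_conj, map_mul,
      Complex.conj_ofReal, Complex.conj_I, smul_eq_mul]
    rw [mul_comm]
    congr 2
    push_cast
    ring
  · simp only [truncChar, Set.indicator_of_notMem h, RCLike.inner_apply, map_zero, smul_zero,
      mul_zero]

theorem coeFn_fourier_cut {A : Set Plane} (hA : MeasurableSet A) (hv : volume A ≠ ∞) (f : L2) :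
    (𝓕 (cut hA f) : L2) =ᵐ[volume] (𝓕 (A.indicator f) : Plane → ℂ) := by
  have h : cut hA f = ((Lp.memLp f).indicator hA).toLp _ := rfl
  rw [h]
  exact coeFn_fourier_toLp (integrable_indicator_of_L2 hA hv f) _

/-- Weak convergence gives pointwise convergence of the transforms of the truncations. By
Cauchy–Schwarz they are uniformly bounded, and `B` has finite measure, so dominated convergence
upgrades this to norm convergence on `B`. -/
theorem tendsto_cut_fourier_cut {A B : Set Plane} (hA : MeasurableSet A) (hB : MeasurableSet B)
    (hvA : volume A ≠ ∞) (hvB : volume B ≠ ∞) {d : ℕ → L2} {C : ℝ} (hC : ∀ n, ‖d n‖ ≤ C)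
    (hd : ∀ e : L2, Tendsto (fun n => ⟪e, d n⟫_ℂ) atTop (𝓝 0)) :
    Tendsto (fun n => cut hB (𝓕 (cut hA (d n)) : L2)) atTop (𝓝 0) := by
  set M : ℝ := (eLpNorm (A.indicator fun _ => (1 : ℂ)) 2 volume).toReal
  have hM : ∀ w, ‖(memLp_truncChar hA hvA w).toLp _‖ = M := fun w => by
    rw [Lp.norm_toLp, eLpNorm_congr_norm_ae (Eventually.of_forall (norm_truncChar A w))]
  have : IsFiniteMeasure (volume.restrict B) := ⟨by simpa using hvB.lt_top⟩
  have h : Tendsto (fun n => ∫ w in B, ‖(𝓕 (A.indicator (d n)) : Plane → ℂ) w‖ ^ 2) atTop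
      (𝓝 (∫ _ in B, (0 : ℝ))) := by
    refine tendsto_integral_of_dominated_convergence (fun _ => (M * C) ^ 2) (fun n => ?_)
      (integrable_const _) (fun n => Eventually.of_forall fun w => ?_)
      (Eventually.of_forall fun w => ?_)
    · exact ((continuous_fourier_of_integrable
        (integrable_indicator_of_L2 hA hvA (d n))).norm.pow 2).aestronglyMeasurable
    · rw [fourier_indicator_eq_inner hA hvA, Real.norm_of_nonneg (by positivity)]
      refine pow_le_pow_left₀ (norm_nonneg _) ((norm_inner_le_norm _ _).trans ?_) 2
      rw [hM]
      exact mul_le_mul_of_nonneg_left (hC n) ENNReal.toReal_nonneg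
    · simp_rw [fourier_indicator_eq_inner hA hvA]
      have := ((hd ((memLp_truncChar hA hvA w).toLp _)).norm).pow 2
      simpa using this
  rw [integral_zero] at h
  rw [tendsto_zero_iff_norm_tendsto_zero]
  have h2 := (Real.continuous_sqrt.tendsto 0).comp h
  rw [Real.sqrt_zero] at h2
  refine h2.congr fun n => ?_
  rw [Function.comp_apply, ← Real.sqrt_sq (norm_nonneg (cut hB _)), norm_cut_sq]
  congr 1
  refine setIntegral_congr_ae hB ?_
  filter_upwards [coeFn_fourier_cut hA hvA (d n)] with w hw _
  rw [hw]

/-- Localisation to `A` in space followed by localisation to `B` in frequency. -/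
def loc {A B : Set Plane} (hA : MeasurableSet A) (hB : MeasurableSet B) : L2 →L[ℂ] L2 :=
  ((Lp.fourierTransformₗᵢ Plane ℂ).symm.toLinearIsometry.toContinuousLinearMap).comp
    ((cut hB).comp
      (((Lp.fourierTransformₗᵢ Plane ℂ).toLinearIsometry.toContinuousLinearMap).comp (cut hA)))

theorem loc_apply {A B : Set Plane} (hA : MeasurableSet A) (hB : MeasurableSet B) (f : L2) :
    loc hA hB f = (Lp.fourierTransformₗᵢ Plane ℂ).symm (cut hB (𝓕 (cut hA f) : L2)) := rfl

theorem fourier_loc {A B : Set Plane} (hA : MeasurableSet A) (hB : MeasurableSet B) (f : L2) :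
    (𝓕 (loc hA hB f) : L2) = cut hB (𝓕 (cut hA f) : L2) :=
  (Lp.fourierTransformₗᵢ Plane ℂ).apply_symm_apply _

theorem norm_sub_loc_le {A B : Set Plane} (hA : MeasurableSet A) (hB : MeasurableSet B) (f : L2) :
    ‖f - loc hA hB f‖ ≤ ‖cut hA.compl f‖ + ‖cut hB.compl (𝓕 f : L2)‖ := by
  have h1 : cut hA f = f - cut hA.compl f := eq_sub_of_add_eq (cut_add_cut_compl hA f)
  have h2 : (𝓕 f : L2) - cut hB (𝓕 f : L2) = cut hB.compl (𝓕 f : L2) :=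
    sub_eq_of_eq_add' (cut_add_cut_compl hB _).symm
  have h3 : (𝓕 (cut hA f) : L2) = 𝓕 f - 𝓕 (cut hA.compl f) := by
    rw [h1]
    exact map_sub (Lp.fourierTransformₗᵢ Plane ℂ) _ _
  have h4 : (𝓕 (f - loc hA hB f) : L2) =
      cut hB (𝓕 (cut hA.compl f) : L2) + cut hB.compl (𝓕 f : L2) := by
    have : (𝓕 (f - loc hA hB f) : L2) = 𝓕 f - 𝓕 (loc hA hB f) :=
      map_sub (Lp.fourierTransformₗᵢ Plane ℂ) _ _
    rw [this, fourier_loc, h3, map_sub, ← h2]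
    abel
  rw [← Lp.norm_fourier_eq (f - loc hA hB f), h4]
  refine (norm_add_le _ _).trans (add_le_add ?_ le_rfl)
  exact (norm_cut_le hB _).trans_eq (Lp.norm_fourier_eq _)

/-- The operator maps weakly convergent sequences to norm convergent ones, and the unit ball is
weakly sequentially compact. -/
theorem isCompactOperator_loc {A B : Set Plane} (hA : MeasurableSet A) (hB : MeasurableSet B)
    (hvA : volume A ≠ ∞) (hvB : volume B ≠ ∞) : IsCompactOperator (loc hA hB) := by
  have hc : IsCompact ((loc hA hB) '' Metric.closedBall 0 1) := by
    refine IsSeqCompact.isCompact fun y hy => ?_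
    choose f hf hfy using hy
    obtain ⟨g, hg, φ, hφ, hlim⟩ := exists_weakly_convergent_subseq f
      (fun n => by simpa using hf n)
    refine ⟨loc hA hB g, ⟨g, by simpa using hg, rfl⟩, φ, hφ, ?_⟩
    have h := tendsto_cut_fourier_cut hA hB hvA hvB (d := fun n => f (φ n) - g) (C := 2)
      (fun n => (norm_sub_le _ _).trans (by
        have : ‖f (φ n)‖ ≤ 1 := by simpa using hf (φ n)
        linarith)) (fun e => by
        have := (Complex.continuous_conj.tendsto _).comp
          ((hlim e).sub (tendsto_const_nhds (x := ⟪g, e⟫_ℂ)))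
        simp only [sub_self, map_zero] at this
        refine this.congr fun n => ?_
        simp [inner_sub_right])
    have h2 := ((Lp.fourierTransformₗᵢ Plane ℂ).symm.continuous.tendsto 0).comp h
    rw [map_zero] at h2
    rw [tendsto_iff_norm_sub_tendsto_zero]
    rw [tendsto_zero_iff_norm_tendsto_zero] at h2
    refine h2.congr fun n => ?_
    rw [Function.comp_apply, Function.comp_apply, ← hfy, ← map_sub, loc_apply]
  exact ⟨_, hc, mem_of_superset (Metric.closedBall_mem_nhds 0 one_pos)
    (Set.subset_preimage_image _ _)⟩

/-! ### The uncertainty principle -/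

/-- The Paley–Wiener mechanism: a phase bounded on the support of `h` keeps the exponential bounded
for complex `z` near `z₀`, which allows differentiation under the integral. -/
theorem differentiable_integral_exp_mul {c : Plane → ℝ} (hc : Continuous c) {h : Plane → ℂ}
    (hh : Integrable h) {M : ℝ} (hM : ∀ v, h v ≠ 0 → |c v| ≤ M) :
    Differentiable ℂ fun z : ℂ => ∫ v, Complex.exp (c v * Complex.I * z) * h v := by
  intro z₀
  have hcont : ∀ z : ℂ, Continuous fun v => Complex.exp (c v * Complex.I * z) := fun z => by
    fun_prop
  have hbound : ∀ v, h v ≠ 0 → ∀ z ∈ Metric.ball z₀ 1,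
      ‖Complex.exp (c v * Complex.I * z)‖ ≤ Real.exp (M * (‖z₀‖ + 1)) := by
    intro v hv z hz
    rw [Complex.norm_exp]
    refine Real.exp_le_exp.2 ((Complex.re_le_norm _).trans ?_)
    rw [norm_mul, norm_mul, Complex.norm_I, mul_one, Complex.norm_real, Real.norm_eq_abs]
    refine mul_le_mul (hM v hv) ?_ (norm_nonneg _) ((abs_nonneg _).trans (hM v hv))
    have h1 : ‖z - z₀‖ < 1 := by simpa [dist_eq_norm] using hz
    have h2 := norm_add_le z₀ (z - z₀)
    rw [add_sub_cancel] at h2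
    linarith
  refine (hasDerivAt_integral_of_dominated_loc_of_deriv_le
    (F' := fun z v => Complex.exp (c v * Complex.I * z) * (c v * Complex.I) * h v)
    (bound := fun v => Real.exp (M * (‖z₀‖ + 1)) * M * ‖h v‖)
    (Metric.ball_mem_nhds z₀ one_pos)
    (Eventually.of_forall fun z => (hcont z).aestronglyMeasurable.mul hh.1) ?_ ?_ ?_ ?_ ?_
    ).2.differentiableAt
  · refine (hh.norm.const_mul (Real.exp (M * (‖z₀‖ + 1)))).mono
      ((hcont z₀).aestronglyMeasurable.mul hh.1) (Eventually.of_forall fun v => ?_)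
    by_cases hv : h v = 0
    · simp [hv]
    · rw [Pi.mul_apply, norm_mul, norm_mul, norm_norm, Real.norm_of_nonneg (Real.exp_pos _).le]
      exact mul_le_mul_of_nonneg_right (hbound v hv z₀ (Metric.mem_ball_self one_pos))
        (norm_nonneg _)
  · refine AEStronglyMeasurable.mul (Continuous.aestronglyMeasurable ?_) hh.1
    exact (hcont z₀).mul (by fun_prop)
  · refine Eventually.of_forall fun v z hz => ?_
    by_cases hv : h v = 0
    · simp [hv]
    · rw [norm_mul, norm_mul, norm_mul, Complex.norm_I, mul_one, Complex.norm_real,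
        Real.norm_eq_abs]
      refine mul_le_mul_of_nonneg_right ?_ (norm_nonneg _)
      exact mul_le_mul (hbound v hv z hz) (hM v hv) (abs_nonneg _) (Real.exp_pos _).le
  · exact hh.norm.const_mul _
  · refine Eventually.of_forall fun v z _ => ?_
    have h1 : HasDerivAt (fun z : ℂ => (c v * Complex.I : ℂ) * z) (c v * Complex.I) z := by
      simpa using (hasDerivAt_id z).const_mul (c v * Complex.I : ℂ)
    exact h1.cexp.mul_const _

/-- An integrable function with bounded support whose Fourier transform vanishes outside a ball
has vanishing Fourier transform away from the origin. -/
theorem fourier_eq_zero_of_bounded_support {h : Plane → ℂ} (hh : Integrable h) {r s : ℝ}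
    (hr : ∀ v, h v ≠ 0 → ‖v‖ ≤ r) (hs : ∀ w, s < ‖w‖ → (𝓕 h : Plane → ℂ) w = 0) {w : Plane}
    (hw : w ≠ 0) : (𝓕 h : Plane → ℂ) w = 0 := by
  set c : Plane → ℝ := fun v => -2 * Real.pi * ⟪v, w⟫_ℝ with hc
  have hd : Differentiable ℂ fun z : ℂ => ∫ v, Complex.exp (c v * Complex.I * z) * h v := by
    refine differentiable_integral_exp_mul (by fun_prop) hh (M := 2 * Real.pi * (r * ‖w‖))
      fun v hv => ?_
    rw [hc, abs_mul, abs_mul, abs_neg, abs_two, abs_of_pos Real.pi_pos]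
    refine mul_le_mul_of_nonneg_left ((abs_real_inner_le_norm v w).trans ?_) (by positivity)
    exact mul_le_mul_of_nonneg_right (hr v hv) (norm_nonneg _)
  have hre : ∀ t : ℝ, ∫ v, Complex.exp (c v * Complex.I * (t : ℂ)) * h v =
      (𝓕 h : Plane → ℂ) (t • w) := fun t => by
    rw [Real.fourier_eq']
    refine integral_congr_ae (Eventually.of_forall fun v => ?_)
    simp only [hc, smul_eq_mul, real_inner_smul_right]
    congr 2
    push_cast
    ring
  have hw0 : 0 < ‖w‖ := norm_pos_iff.2 hw
  -- Beyond `t₀` the points `t • w` have norm larger than `s`, so the entire extension along the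
  -- line through `w` has zeros accumulating at `t₀` and vanishes identically, in particular at 1.
  set t₀ : ℝ := |s| / ‖w‖ + 1 with ht₀
  have hpos : 0 ≤ |s| / ‖w‖ := by positivity
  have hfreq : ∃ᶠ z : ℂ in 𝓝[≠] (t₀ : ℂ), (fun z : ℂ =>
      ∫ v, Complex.exp (c v * Complex.I * z) * h v) z = 0 := by
    have htend : Tendsto (fun t : ℝ => (t : ℂ)) (𝓝[>] t₀) (𝓝[≠] (t₀ : ℂ)) := by
      refine tendsto_nhdsWithin_iff.2 ⟨?_, ?_⟩
      · exact (Complex.continuous_ofReal.tendsto t₀).mono_left nhdsWithin_le_nhds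
      · filter_upwards [self_mem_nhdsWithin] with t ht
        exact fun h' => (ne_of_gt ht) (Complex.ofReal_injective h')
    refine htend.frequently (Eventually.frequently ?_)
    filter_upwards [self_mem_nhdsWithin] with t ht
    have ht' : t₀ < t := ht
    rw [hre]
    refine hs _ ?_
    rw [norm_smul, Real.norm_of_nonneg (by linarith)]
    have h1 : |s| / ‖w‖ < t := by linarith
    rw [div_lt_iff₀ hw0] at h1
    exact (le_abs_self s).trans_lt h1
  have hzero := AnalyticOnNhd.eqOn_zero_of_preconnected_of_frequently_eq_zero
    (hd.differentiableOn.analyticOnNhd isOpen_univ) isPreconnected_univ (Set.mem_univ (t₀ : ℂ))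
    hfreq
  have h1 := hzero (Set.mem_univ ((1 : ℝ) : ℂ))
  simp only [Pi.zero_apply] at h1
  rw [hre 1, one_smul] at h1
  exact h1

/-- Continuity of the Fourier integral turns its vanishing almost everywhere on an open set into
vanishing everywhere there; analyticity then spreads it to all nonzero frequencies, and the origin
is a null set. -/
theorem eq_zero_of_cut_eq {f : L2} {r s : ℝ} (hf : cut (measurableSet_ext r).compl f = f)
    (hg : cut (measurableSet_ext s).compl (𝓕 f : L2) = 𝓕 f) : f = 0 := by
  set h : Plane → ℂ := (ext r)ᶜ.indicator f with hh
  have hint : Integrable h :=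
    integrable_indicator_of_L2 (measurableSet_ext r).compl (measure_ext_compl_ne_top r) f
  have hF : (𝓕 f : L2) =ᵐ[volume] (𝓕 h : Plane → ℂ) := by
    have := coeFn_fourier_cut (measurableSet_ext r).compl (measure_ext_compl_ne_top r) f
    rwa [hf] at this
  have hopen : IsOpen {w : Plane | s < ‖w‖} := isOpen_lt continuous_const continuous_norm
  have hae : (𝓕 h : Plane → ℂ) =ᵐ[volume.restrict {w : Plane | s < ‖w‖}] fun _ => 0 := by
    rw [EventuallyEq, ae_restrict_iff' hopen.measurableSet]
    have h2 := coeFn_cut (measurableSet_ext s).compl (𝓕 f : L2)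
    rw [hg] at h2
    filter_upwards [hF, h2] with w h1 h2 hw
    rw [← h1, h2, Set.indicator_of_notMem]
    exact fun h' => h' hw.le
  have hzero := Measure.eqOn_open_of_ae_eq hae hopen
    (continuous_fourier_of_integrable hint).continuousOn continuousOn_const
  have hall : ∀ w, w ≠ 0 → (𝓕 h : Plane → ℂ) w = 0 := fun w hw =>
    fourier_eq_zero_of_bounded_support hint (r := r) (s := s) (fun v hv => by
      by_contra hcon
      refine hv (Set.indicator_of_notMem (Set.notMem_compl_iff.2
        (show v ∈ ext r from (not_le.1 hcon).le)) _)) (fun w hw => hzero hw) hw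
  have h0 : (𝓕 f : L2) = 0 := by
    refine Lp.ext ?_
    filter_upwards [hF, Lp.coeFn_zero ℂ 2 (volume : Measure Plane),
      (compl_mem_ae_iff.2 (measure_singleton (0 : Plane)) :
        ({(0 : Plane)}ᶜ : Set Plane) ∈ ae volume)] with w h1 h2 h3
    rw [h1, h2, hall w h3, Pi.zero_apply]
  rw [← norm_eq_zero, ← Lp.norm_fourier_eq, h0, norm_zero]

/-- The uncertainty principle: an `L²` function is controlled by its restriction to the exterior
of a ball and the restriction of its Fourier transform to the exterior of a ball. -/
theorem exists_norm_le_cut_ext (r s : ℝ) : ∃ C : ℝ, 0 ≤ C ∧ ∀ f : L2,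
    ‖f‖ ≤ C * (‖cut (measurableSet_ext r) f‖ + ‖cut (measurableSet_ext s) (𝓕 f : L2)‖) := by
  set hA := (measurableSet_ext r).compl
  set hB := (measurableSet_ext s).compl
  have hcomp := isCompactOperator_loc hA hB (measure_ext_compl_ne_top r)
    (measure_ext_compl_ne_top s)
  have hne : ¬ Module.End.HasEigenvalue (loc hA hB : Module.End ℂ L2) 1 := by
    intro hev
    obtain ⟨f, hf⟩ := hev.exists_hasEigenvector
    have h1 : loc hA hB f = f := by simpa using hf.apply_eq_smul
    have h2 : cut hB (𝓕 (cut hA f) : L2) = (𝓕 f : L2) := by rw [← fourier_loc, h1]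
    -- A fixed point of `loc` loses no norm under either cut, so by orthogonality it is supported in
    -- `A` and its transform in `B`.
    have h3 : ‖f‖ ≤ ‖cut hA f‖ := by
      rw [← Lp.norm_fourier_eq f, ← h2, ← Lp.norm_fourier_eq (cut hA f)]
      exact norm_cut_le hB _
    have h4 := norm_sq_eq_cut_add hA f
    have h5 : ‖cut hA.compl f‖ = 0 := by
      have h6 := norm_cut_le hA f
      have h7 : ‖cut hA f‖ = ‖f‖ := le_antisymm h6 h3
      rw [h7] at h4
      exact pow_eq_zero_iff (two_ne_zero) |>.1 (by linarith)
    have h6 : cut hA f = f := by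
      have := cut_add_cut_compl hA f
      rwa [norm_eq_zero.1 h5, add_zero] at this
    rw [h6] at h2
    exact hf.2 (eq_zero_of_cut_eq h6 h2)
  -- Fredholm alternative: for a compact operator without eigenvalue 1, `loc - 1` is bounded below,
  -- and `norm_sub_loc_le` bounds it above by the two exterior pieces.
  obtain ⟨K, hK⟩ := hcomp.antilipschitz_of_not_hasEigenvalue one_ne_zero hne
  refine ⟨K, K.2, fun f => ?_⟩
  have h1 := hK.le_mul_dist f 0
  rw [map_zero, dist_zero_right, dist_zero_right] at h1
  refine h1.trans (mul_le_mul_of_nonneg_left ?_ K.2)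
  have h2 : (loc hA hB - (1 : ℂ) • (1 : L2 →L[ℂ] L2)) f = -(f - loc hA hB f) := by simp
  rw [h2, norm_neg]
  refine (norm_sub_loc_le hA hB f).trans (le_of_eq ?_)
  simp only [compl_compl]

/-! ### Topology of the space of orbits -/

/-- The saturation of an open set is the union of its preimages under the group elements, each of
which is a homeomorphism. -/
theorem isOpenMap_orbit : IsOpenMap orbit := by
  intro U hU
  refine isQuotientMap_quotient_mk'.isOpen_preimage.1 ?_
  change IsOpen (orbit ⁻¹' (orbit '' U))
  have h : orbit ⁻¹' (orbit '' U) = ⋃ g : G, (fun u : L2h1 => g • u) ⁻¹' U := by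
    ext v
    simp only [Set.mem_preimage, Set.mem_image, Set.mem_iUnion]
    constructor
    · rintro ⟨w, hw, hwv⟩
      obtain ⟨g, hg⟩ := Quotient.exact hwv
      exact ⟨g, by simpa only [hg] using hw⟩
    · rintro ⟨g, hg⟩
      exact ⟨g • v, hg, Quotient.sound ⟨g, rfl⟩⟩
  rw [h]
  exact isOpen_iUnion fun g => hU.preimage (g : L2h1 ≃ₗᵢ[ℂ] L2h1).continuous

theorem continuous_orbit : Continuous orbit := continuous_quotient_mk'

theorem orbit_sym (θ : ℝ) (ξ₀ x₀ : Plane) (l : {r : ℝ // 0 < r}) (u : L2h1) :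
    orbit (sym θ ξ₀ x₀ l u) = orbit u :=
  Quotient.sound ⟨⟨sym θ ξ₀ x₀ l, θ, ξ₀, x₀, l, rfl⟩, rfl⟩

theorem exists_sym_of_orbit_eq {u v : L2h1} (h : orbit u = orbit v) :
    ∃ (θ : ℝ) (ξ₀ x₀ : Plane) (l : {r : ℝ // 0 < r}), u = sym θ ξ₀ x₀ l v := by
  obtain ⟨⟨g, θ, ξ₀, x₀, l, rfl⟩, hg⟩ := Quotient.exact h
  exact ⟨θ, ξ₀, x₀, l, hg.symm⟩

/-- Since `G` acts by isometries, the closure of the image of a ball of radius `ε / 2` lies in the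
image of the ball of radius `ε`. Regularity stands in for the Hausdorff property in
`isCompact_closure_orbits`. -/
instance : RegularSpace Orbits := by
  refine RegularSpace.of_exists_mem_nhds_isClosed_subset fun p s hs => ?_
  obtain ⟨f, rfl⟩ : ∃ f, orbit f = p := Quotient.exists_rep p
  obtain ⟨ε, hε, hball⟩ := Metric.mem_nhds_iff.1 (continuous_orbit.continuousAt hs)
  refine ⟨closure (orbit '' Metric.ball f (ε / 2)),
    mem_of_superset (isOpenMap_orbit.image_mem_nhds (Metric.ball_mem_nhds f (half_pos hε)))
      subset_closure, isClosed_closure, fun q hq => ?_⟩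
  obtain ⟨h, rfl⟩ : ∃ h, orbit h = q := Quotient.exists_rep q
  obtain ⟨_, ⟨a, ha, rfl⟩, b, hb, hab⟩ := mem_closure_iff_nhds.1 hq _
    (isOpenMap_orbit.image_mem_nhds (Metric.ball_mem_nhds h (half_pos hε)))
  obtain ⟨θ, ξ₀, x₀, l, rfl⟩ := exists_sym_of_orbit_eq hab
  rw [← orbit_sym θ ξ₀ x₀ l h]
  refine hball ?_
  rw [Metric.mem_ball] at *
  have h1 : dist (sym θ ξ₀ x₀ l h) (sym θ ξ₀ x₀ l a) < ε / 2 := by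
    rwa [LinearIsometryEquiv.dist_map, dist_comm]
  exact (dist_triangle _ _ _).trans_lt (by linarith)

/-! ### Componentwise operators on `L²h¹` -/

namespace L2h1

theorem comp_sub (u v : L2h1) (j : ℤ) : (u - v).comp j = u.comp j - v.comp j := rfl

theorem one_le_bracket (j : ℤ) : 1 ≤ bracket j :=
  Real.one_le_sqrt.2 (by nlinarith [sq_nonneg (j : ℝ)])

theorem norm_comp_le (u : L2h1) (j : ℤ) : ‖u.comp j‖ ≤ ‖u‖ := by
  refine (sq_le_sq₀ (norm_nonneg _) (norm_nonneg _)).1 ?_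
  rw [norm_sq]
  refine le_trans ?_ (u.summable_comp.le_tsum j fun i _ => by positivity)
  have h := one_le_bracket j
  exact le_mul_of_one_le_left (by positivity) (by nlinarith)

/-- The `j`-th component as a continuous linear map. -/
def compCLM (j : ℤ) : L2h1 →L[ℂ] L2 :=
  LinearMap.mkContinuous
    { toFun := fun u => u.comp j
      map_add' := fun _ _ => rfl
      map_smul' := fun _ _ => rfl } 1 fun u => by
    rw [one_mul]
    exact norm_comp_le u j

theorem compCLM_apply (j : ℤ) (u : L2h1) : compCLM j u = u.comp j := rfl

theorem hasSum_norm_single (j : ℤ) (f : L2) :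
    HasSum (fun i : ℤ => bracket i ^ 2 * ‖(Pi.single j f : ℤ → L2) i‖ ^ 2)
      (bracket j ^ 2 * ‖f‖ ^ 2) := by
  have h := _root_.hasSum_single (f := fun i : ℤ => bracket i ^ 2 * ‖(Pi.single j f : ℤ → L2) i‖ ^ 2) j
    (fun i hi => by simp [Pi.single_eq_of_ne hi])
  simpa using h

/-- The sequence with `j`-th component `f` and all others zero. -/
def single (j : ℤ) : L2 →L[ℂ] L2h1 :=
  LinearMap.mkContinuous
    { toFun := fun f => ⟨Pi.single j f, (hasSum_norm_single j f).summable⟩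
      map_add' := fun f g => by
        refine Subtype.ext ?_
        change (Pi.single j (f + g) : ℤ → L2) = (Pi.single j f : ℤ → L2) + Pi.single j g
        exact Pi.single_add (f := fun _ : ℤ => L2) j f g
      map_smul' := fun c f => by
        refine Subtype.ext ?_
        change (Pi.single j (c • f) : ℤ → L2) = c • (Pi.single j f : ℤ → L2)
        exact Pi.single_smul' j c f } (bracket j) fun f => by
    refine (sq_le_sq₀ (norm_nonneg _) (mul_nonneg (bracket_pos j).le (norm_nonneg _))).1 ?_
    rw [norm_sq, mul_pow]
    exact (hasSum_norm_single j f).tsum_eq.le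

theorem comp_single (j i : ℤ) (f : L2) : (single j f).comp i = (Pi.single j f : ℤ → L2) i := rfl

/-- `L²h¹` is isometric to `ℓ²(ℤ; L²)`. -/
theorem toLp_surjective : Function.Surjective toLp := by
  intro w
  have hw : ∀ j, (bracket j : ℂ) • ((bracket j : ℂ)⁻¹ • w j) = w j := fun j =>
    smul_inv_smul₀ (Complex.ofReal_ne_zero.2 (bracket_pos j).ne') _
  refine ⟨⟨fun j => (bracket j : ℂ)⁻¹ • w j, (weighted_memlp_iff _).1 ?_⟩, lp.ext (funext hw)⟩
  simp_rw [hw]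
  exact lp.memℓp w

instance : CompleteSpace L2h1 := by
  have hi : Isometry toLp := AddMonoidHomClass.isometry_of_norm toLp fun _ => rfl
  exact (completeSpace_congr (e := Equiv.ofBijective toLp ⟨toLp_injective, toLp_surjective⟩)
    hi.isUniformEmbedding).2 inferInstance

/-- The operator acting by the contraction `T j` on the `j`-th component. -/
def diag (T : ℤ → L2 →L[ℂ] L2) (hT : ∀ j f, ‖T j f‖ ≤ ‖f‖) : L2h1 →L[ℂ] L2h1 :=
  have hle : ∀ (u : L2h1) j, bracket j ^ 2 * ‖T j (u.comp j)‖ ^ 2 ≤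
      bracket j ^ 2 * ‖u.comp j‖ ^ 2 := fun u j =>
    mul_le_mul_of_nonneg_left (pow_le_pow_left₀ (norm_nonneg _) (hT j _) 2) (by positivity)
  have hsum : ∀ u : L2h1, Summable fun j => bracket j ^ 2 * ‖T j (u.comp j)‖ ^ 2 := fun u =>
    Summable.of_nonneg_of_le (fun j => by positivity) (hle u) u.summable_comp
  LinearMap.mkContinuous
    { toFun := fun u => ⟨fun j => T j (u.comp j), hsum u⟩
      map_add' := fun u v => Subtype.ext (funext fun j => (T j).map_add (u.comp j) (v.comp j))
      map_smul' := fun c u => Subtype.ext (funext fun j => (T j).map_smul c (u.comp j)) }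
    1 fun u => by
      rw [one_mul]
      refine (sq_le_sq₀ (norm_nonneg _) (norm_nonneg _)).1 ?_
      rw [norm_sq, norm_sq]
      exact (hsum u).tsum_le_tsum (hle u) u.summable_comp

section diag

variable {T : ℤ → L2 →L[ℂ] L2} {hT : ∀ j f, ‖T j f‖ ≤ ‖f‖}

theorem comp_diag (u : L2h1) (j : ℤ) : (diag T hT u).comp j = T j (u.comp j) := rfl

theorem norm_diag_sq (u : L2h1) :
    ‖diag T hT u‖ ^ 2 = ∑' j : ℤ, bracket j ^ 2 * ‖T j (u.comp j)‖ ^ 2 :=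
  norm_sq _

theorem norm_diag_le (u : L2h1) : ‖diag T hT u‖ ≤ ‖u‖ := by
  refine (sq_le_sq₀ (norm_nonneg _) (norm_nonneg _)).1 ?_
  rw [norm_sq, norm_sq]
  exact (diag T hT u).summable_comp.tsum_le_tsum (fun j =>
    mul_le_mul_of_nonneg_left (pow_le_pow_left₀ (norm_nonneg _) (hT j _) 2) (by positivity))
    u.summable_comp

theorem norm_le_of_comp_le {u v : L2h1} (h : ∀ j, ‖u.comp j‖ ≤ ‖v.comp j‖) : ‖u‖ ≤ ‖v‖ := by
  refine (sq_le_sq₀ (norm_nonneg _) (norm_nonneg _)).1 ?_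
  rw [norm_sq, norm_sq]
  exact u.summable_comp.tsum_le_tsum (fun j =>
    mul_le_mul_of_nonneg_left (pow_le_pow_left₀ (norm_nonneg _) (h j) 2) (by positivity))
    v.summable_comp

theorem norm_eq_of_comp_eq {u v : L2h1} (h : ∀ j, ‖u.comp j‖ = ‖v.comp j‖) : ‖u‖ = ‖v‖ :=
  le_antisymm (norm_le_of_comp_le fun j => (h j).le) (norm_le_of_comp_le fun j => (h j).ge)

/-- Contractions converging to zero in each component converge to zero on `L²h¹`. -/
theorem tendsto_diag {ι : Type*} {l : Filter ι} {T : ι → ℤ → L2 →L[ℂ] L2}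
    {hT : ∀ i j f, ‖T i j f‖ ≤ ‖f‖} (u : L2h1)
    (h : ∀ j, Tendsto (fun i => T i j (u.comp j)) l (𝓝 0)) :
    Tendsto (fun i => diag (T i) (hT i) u) l (𝓝 0) := by
  have h1 : Tendsto (fun i => ∑' j : ℤ, bracket j ^ 2 * ‖T i j (u.comp j)‖ ^ 2) l
      (𝓝 (∑' _ : ℤ, (0 : ℝ))) := by
    refine tendsto_tsum_of_dominated_convergence u.summable_comp (fun j => ?_)
      (Eventually.of_forall fun i j => ?_)
    · have := (((h j).norm).pow 2).const_mul (bracket j ^ 2)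
      simpa using this
    · rw [Real.norm_of_nonneg (by positivity)]
      exact mul_le_mul_of_nonneg_left (pow_le_pow_left₀ (norm_nonneg _) (hT i j _) 2)
        (by positivity)
  rw [tsum_zero] at h1
  rw [tendsto_zero_iff_norm_tendsto_zero]
  have h2 := (Real.continuous_sqrt.tendsto 0).comp h1
  rw [Real.sqrt_zero] at h2
  refine h2.congr fun i => ?_
  rw [Function.comp_apply, ← norm_diag_sq (hT := hT i), Real.sqrt_sq (norm_nonneg _)]

/-- Restriction of all components to a measurable set. -/
def restr {A : Set Plane} (hA : MeasurableSet A) : L2h1 →L[ℂ] L2h1 :=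
  diag (fun _ => cut hA) fun _ f => norm_cut_le hA f

/-- The Fourier transform of all components. -/
def fourier : L2h1 →L[ℂ] L2h1 :=
  diag (fun _ => hatL.toContinuousLinearMap) fun _ f => (hatL.norm_map f).le

theorem norm_fourier (u : L2h1) : ‖fourier u‖ = ‖u‖ :=
  norm_eq_of_comp_eq fun _ => hatL.norm_map _

/-- The components of index `|j| > K`. -/
def highModes (K : ℕ) : L2h1 →L[ℂ] L2h1 :=
  diag (fun j => if (K : ℤ) < |j| then ContinuousLinearMap.id ℂ L2 else 0) fun _ f => by
    split_ifs <;> simp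

theorem comp_highModes (K : ℕ) (u : L2h1) (j : ℤ) :
    (highModes K u).comp j = if (K : ℤ) < |j| then u.comp j else 0 := by
  unfold highModes
  rw [comp_diag]
  split_ifs <;> rfl

theorem tendsto_highModes (u : L2h1) : Tendsto (fun K : ℕ => highModes K u) atTop (𝓝 0) := by
  refine tendsto_diag u fun j => tendsto_const_nhds.congr' ?_
  filter_upwards [eventually_ge_atTop j.natAbs] with K hK
  rw [if_neg]
  · rfl
  · rw [not_lt, Int.abs_eq_natAbs]
    exact_mod_cast hK

theorem tendsto_restr_ext (u : L2h1) :
    Tendsto (fun r : ℝ => restr (measurableSet_ext r) u) atTop (𝓝 0) :=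
  tendsto_diag u fun _ => tendsto_cut_ext _

theorem exists_norm_restr_lt (u : L2h1) {ε : ℝ} (hε : 0 < ε) :
    ∃ δ : ℝ, 0 < δ ∧ ∀ (A : Set Plane) (hA : MeasurableSet A),
      volume A ≤ ENNReal.ofReal δ → ‖restr hA u‖ < ε := by
  -- The filter of measurable sets of measure tending to zero; with it, uniform smallness over sets
  -- becomes an instance of `tendsto_diag`.
  set l : Filter {A : Set Plane // MeasurableSet A} := comap (fun A => volume A.1) (𝓝 0)
  have hbasis : ∀ δ : ℝ, 0 < δ → ∀ᶠ A in l, volume A.1 ≤ ENNReal.ofReal δ := fun δ hδ =>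
    tendsto_comap.eventually (Iic_mem_nhds (ENNReal.ofReal_pos.2 hδ))
  have h : Tendsto (fun A : {A : Set Plane // MeasurableSet A} => restr A.2 u) l (𝓝 0) := by
    refine tendsto_diag u fun j => ?_
    rw [Metric.tendsto_nhds]
    intro η hη
    obtain ⟨δ, hδ, hδ'⟩ := exists_norm_cut_le (u.comp j) (half_pos hη)
    filter_upwards [hbasis δ hδ] with A hA
    rw [dist_zero_right]
    exact (hδ' A.1 A.2 hA).trans_lt (half_lt_self hη)
  have h2 := (Metric.tendsto_nhds.1 h) ε hε
  obtain ⟨s, hs, hs'⟩ := h2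
  obtain ⟨δ', hδ', hsub⟩ := (ENNReal.nhds_zero_basis_Iic).mem_iff.1 hs
  -- The minimum with 1 keeps the threshold finite, as `δ'` may be infinite.
  refine ⟨(min δ' 1).toReal, ENNReal.toReal_pos (lt_min hδ' one_pos).ne'
    (ne_top_of_le_ne_top ENNReal.one_ne_top (min_le_right _ _)), fun A hA hv => ?_⟩
  rw [ENNReal.ofReal_toReal (ne_top_of_le_ne_top ENNReal.one_ne_top (min_le_right _ _))] at hv
  have := hs' (a := ⟨A, hA⟩) (hsub (hv.trans (min_le_left _ _)))
  rw [Set.mem_ofPred_eq, dist_zero_right] at this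
  exact this

end diag

end L2h1

/-! ### The quantitative bounds -/

theorem measurableSet_le_norm_sub (x₀ : Plane) (r : ℝ) :
    MeasurableSet {x : Plane | r ≤ ‖x - x₀‖} :=
  (isClosed_le continuous_const (by fun_prop)).measurableSet

theorem spaceMass_eq (K : ℕ) (x₀ : Plane) (r : ℝ) (u : L2h1) :
    spaceMass K x₀ r u = ∑ j ∈ Finset.Icc (-(K : ℤ)) K,
      bracket j ^ 2 * ‖cut (measurableSet_le_norm_sub x₀ r) (u.comp j)‖ ^ 2 := by
  simp only [spaceMass, norm_cut_sq]

theorem freqMass_eq (K : ℕ) (ξ₀ : Plane) (r : ℝ) (u : L2h1) :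
    freqMass K ξ₀ r u = ∑ j ∈ Finset.Icc (-(K : ℤ)) K,
      bracket j ^ 2 * ‖cut (measurableSet_le_norm_sub ξ₀ r) (hatL (u.comp j))‖ ^ 2 := by
  simp only [freqMass, norm_cut_sq]
  refine Finset.sum_congr rfl fun j _ => ?_
  congr 1
  refine setIntegral_congr_ae (measurableSet_le_norm_sub ξ₀ r) ?_
  filter_upwards [coeFn_hatL (u.comp j)] with ξ hξ _
  rw [hξ]

theorem spaceMass_zero_eq (K : ℕ) (r : ℝ) (u : L2h1) :
    spaceMass K 0 r u = ∑ j ∈ Finset.Icc (-(K : ℤ)) K,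
      bracket j ^ 2 * ‖cut (measurableSet_ext r) (u.comp j)‖ ^ 2 := by
  simp only [spaceMass, norm_cut_sq, ext, sub_zero]

theorem freqMass_zero_eq (K : ℕ) (r : ℝ) (u : L2h1) :
    freqMass K 0 r u = ∑ j ∈ Finset.Icc (-(K : ℤ)) K,
      bracket j ^ 2 * ‖cut (measurableSet_ext r) (hatL (u.comp j))‖ ^ 2 := by
  rw [freqMass_eq]
  simp only [norm_cut_sq, ext, sub_zero]

/-- Together with `freqMass_sym`, this is the dictionary between symmetries and the triple `x`, `ξ`,
`N`: the scale is `N = l`, and the centres are the points which the symmetry moves to the origin. -/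
theorem spaceMass_sym (K : ℕ) (θ : ℝ) (ξ₀ x₀ : Plane) (l : {r : ℝ // 0 < r}) (R : ℝ)
    (u : L2h1) : spaceMass K 0 R (sym θ ξ₀ x₀ l u) = spaceMass K (-(l.1⁻¹ • x₀)) (R / l.1) u := by
  rw [spaceMass_zero_eq, spaceMass_eq]
  refine Finset.sum_congr rfl fun j _ => ?_
  rw [sym_apply, comp_symMap,
    norm_cut_symL2 _ (measurableSet_le_norm_sub (-(l.1⁻¹ • x₀)) (R / l.1))]
  intro x
  have h : l.1⁻¹ • (x - x₀) - -(l.1⁻¹ • x₀) = l.1⁻¹ • x := by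
    rw [sub_neg_eq_add, ← smul_add, sub_add_cancel]
  change R ≤ ‖x‖ ↔ R / l.1 ≤ ‖l.1⁻¹ • (x - x₀) - -(l.1⁻¹ • x₀)‖
  rw [h, norm_smul, Real.norm_of_nonneg (inv_pos.2 l.2).le, div_eq_inv_mul,
    mul_le_mul_iff_right₀ (inv_pos.2 l.2)]

theorem freqMass_sym (K : ℕ) (θ : ℝ) (ξ₀ x₀ : Plane) (l : {r : ℝ // 0 < r}) (R : ℝ)
    (u : L2h1) : freqMass K 0 R (sym θ ξ₀ x₀ l u) = freqMass K (-(l.1 • ξ₀)) (R * l.1) u := by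
  rw [freqMass_zero_eq, freqMass_eq]
  refine Finset.sum_congr rfl fun j _ => ?_
  rw [sym_apply, comp_symMap, hatL_symL2,
    norm_cut_symL2 _ (measurableSet_le_norm_sub (-(l.1 • ξ₀)) (R * l.1))]
  intro x
  have h : l.1⁻¹⁻¹ • (x - ξ₀) - -(l.1 • ξ₀) = l.1 • x := by
    rw [sub_neg_eq_add, inv_inv, ← smul_add, sub_add_cancel]
  change R ≤ ‖x‖ ↔ R * l.1 ≤ ‖l.1⁻¹⁻¹ • (x - ξ₀) - -(l.1 • ξ₀)‖
  rw [h, norm_smul, Real.norm_of_nonneg l.2.le, mul_comm R, mul_le_mul_iff_right₀ l.2]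

theorem tailMass_congr {K : ℕ} {u v : L2h1}
    (h : ∀ j : ℤ, (K : ℤ) < |j| → ‖u.comp j‖ = ‖v.comp j‖) : tailMass K u = tailMass K v :=
  tsum_congr fun j => by rw [h j.1 j.2]

theorem tailMass_sym (K : ℕ) (θ : ℝ) (ξ₀ x₀ : Plane) (l : {r : ℝ // 0 < r}) (u : L2h1) :
    tailMass K (sym θ ξ₀ x₀ l u) = tailMass K u :=
  tailMass_congr fun _ _ => (symL2 θ ξ₀ x₀ l).norm_map _

theorem norm_sq_eq_sum_add_tailMass (K : ℕ) (u : L2h1) :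
    ‖u‖ ^ 2 = ∑ j ∈ Finset.Icc (-(K : ℤ)) K, bracket j ^ 2 * ‖u.comp j‖ ^ 2 + tailMass K u := by
  rw [L2h1.norm_sq, ← u.summable_comp.sum_add_tsum_subtype_compl (Finset.Icc (-(K : ℤ)) K)]
  congr 1
  refine (Equiv.tsum_eq (Equiv.subtypeEquivRight fun j => ?_)
    (fun j : {j : ℤ // (K : ℤ) < |j|} => bracket j ^ 2 * ‖u.comp j‖ ^ 2))
  rw [Finset.mem_Icc, ← abs_le, not_le]

/-! ### Boundedness and total boundedness of concentrated sets. -/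

theorem norm_cut_fourier (r : ℝ) (f : L2) :
    ‖cut (measurableSet_ext (r / (2 * Real.pi))) (𝓕 f : L2)‖ =
      ‖cut (measurableSet_ext r) (hatL f)‖ := by
  rw [hatL_apply, norm_cut_symL2 _ (measurableSet_ext (r / (2 * Real.pi)))]
  intro x
  change r ≤ ‖x‖ ↔ r / (2 * Real.pi) ≤ ‖(2 * Real.pi)⁻¹ • (x - 0)‖
  rw [sub_zero, norm_smul, Real.norm_of_nonneg (inv_pos.2 two_pi_pos).le, div_eq_inv_mul,
    mul_le_mul_iff_right₀ (inv_pos.2 two_pi_pos)]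

/-- The uncertainty principle applied to each low mode; it supplies the norm bound that the
concentration hypotheses do not contain. -/
theorem exists_norm_sq_le_mass (K : ℕ) (R : ℝ) : ∃ C : ℝ, 0 ≤ C ∧ ∀ u : L2h1,
    ‖u‖ ^ 2 ≤ C * (spaceMass K 0 R u + freqMass K 0 R u) + tailMass K u := by
  obtain ⟨C, -, hC⟩ := exists_norm_le_cut_ext R (R / (2 * Real.pi))
  refine ⟨2 * C ^ 2, by positivity, fun u => ?_⟩
  rw [norm_sq_eq_sum_add_tailMass K]
  refine add_le_add ?_ le_rfl
  rw [spaceMass_zero_eq, freqMass_zero_eq, ← Finset.sum_add_distrib, Finset.mul_sum]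
  refine Finset.sum_le_sum fun j _ => ?_
  have h := hC (u.comp j)
  rw [norm_cut_fourier] at h
  set a := ‖cut (measurableSet_ext R) (u.comp j)‖
  set b := ‖cut (measurableSet_ext R) (hatL (u.comp j))‖
  have h1 : ‖u.comp j‖ ^ 2 ≤ (C * (a + b)) ^ 2 := pow_le_pow_left₀ (norm_nonneg _) h 2
  have h2 : (C * (a + b)) ^ 2 ≤ 2 * C ^ 2 * (a ^ 2 + b ^ 2) := by
    nlinarith [mul_nonneg (sq_nonneg C) (sq_nonneg (a - b))]
  nlinarith [mul_le_mul_of_nonneg_left (h1.trans h2) (sq_nonneg (bracket j))]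

/-- The operator localising the components of index `|j| ≤ K` to balls of radius `R` in space and
frequency, and annihilating the other components. -/
def locLow (K : ℕ) (R : ℝ) : L2h1 →L[ℂ] L2h1 :=
  ∑ j ∈ Finset.Icc (-(K : ℤ)) K, (L2h1.single j).comp
    ((loc (measurableSet_ext R).compl (measurableSet_ext (R / (2 * Real.pi))).compl).comp
      (L2h1.compCLM j))

theorem isCompactOperator_locLow (K : ℕ) (R : ℝ) : IsCompactOperator (locLow K R) := by
  have h : locLow K R ∈ compactOperator (RingHom.id ℂ) L2h1 L2h1 := by
    refine Submodule.sum_mem _ fun j _ => ?_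
    exact ((isCompactOperator_loc _ _ (measure_ext_compl_ne_top _)
      (measure_ext_compl_ne_top _)).comp_clm (L2h1.compCLM j)).clm_comp (L2h1.single j)
  exact h

theorem comp_locLow (K : ℕ) (R : ℝ) (u : L2h1) (i : ℤ) :
    (locLow K R u).comp i = if i ∈ Finset.Icc (-(K : ℤ)) K then
      loc (measurableSet_ext R).compl (measurableSet_ext (R / (2 * Real.pi))).compl (u.comp i)
      else 0 := by
  rw [← L2h1.compCLM_apply, locLow, sum_apply, map_sum]
  simp only [ContinuousLinearMap.comp_apply, L2h1.compCLM_apply, L2h1.comp_single]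
  rw [← Finset.sum_ite_eq (Finset.Icc (-(K : ℤ)) K) i fun j =>
    loc (measurableSet_ext R).compl (measurableSet_ext (R / (2 * Real.pi))).compl (u.comp j)]
  refine Finset.sum_congr rfl fun j _ => ?_
  rw [Pi.single_apply]

theorem norm_sub_locLow_sq_le (K : ℕ) (R : ℝ) (u : L2h1) :
    ‖u - locLow K R u‖ ^ 2 ≤ 2 * (spaceMass K 0 R u + freqMass K 0 R u) + tailMass K u := by
  rw [norm_sq_eq_sum_add_tailMass K]
  refine add_le_add ?_ (le_of_eq (tailMass_congr fun j hj => ?_))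
  · rw [spaceMass_zero_eq, freqMass_zero_eq, ← Finset.sum_add_distrib, Finset.mul_sum]
    refine Finset.sum_le_sum fun j hj => ?_
    rw [L2h1.comp_sub, comp_locLow, if_pos hj]
    have h := norm_sub_loc_le (measurableSet_ext R).compl
      (measurableSet_ext (R / (2 * Real.pi))).compl (u.comp j)
    simp only [compl_compl] at h
    rw [norm_cut_fourier] at h
    set a := ‖cut (measurableSet_ext R) (u.comp j)‖
    set b := ‖cut (measurableSet_ext R) (hatL (u.comp j))‖
    have h1 := pow_le_pow_left₀ (norm_nonneg _) h 2
    have h2 : (a + b) ^ 2 ≤ 2 * (a ^ 2 + b ^ 2) := by nlinarith [sq_nonneg (a - b)]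
    nlinarith [mul_le_mul_of_nonneg_left (h1.trans h2) (sq_nonneg (bracket j))]
  · rw [L2h1.comp_sub, comp_locLow, if_neg, sub_zero]
    rw [Finset.mem_Icc, ← abs_le, not_le]
    exact hj

/-- A subset of `L²h¹` which is uniformly concentrated in space, in frequency and in the discrete
variable is totally bounded. -/
theorem totallyBounded_of_mass_lt {s : Set L2h1}
    (h : ∀ η : ℝ, 0 < η → ∃ (K : ℕ) (R : ℝ), ∀ u ∈ s,
      tailMass K u < η ∧ spaceMass K 0 R u < η ∧ freqMass K 0 R u < η) : TotallyBounded s := by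
  have hbdd : Bornology.IsBounded s := by
    obtain ⟨K, R, hKR⟩ := h 1 one_pos
    obtain ⟨C, hC0, hC⟩ := exists_norm_sq_le_mass K R
    refine isBounded_iff_forall_norm_le.2 ⟨2 * C + 1 + 1, fun u hu => ?_⟩
    obtain ⟨h1, h2, h3⟩ := hKR u hu
    have h4 : ‖u‖ ^ 2 ≤ C * (1 + 1) + 1 :=
      (hC u).trans (add_le_add (mul_le_mul_of_nonneg_left (add_le_add h2.le h3.le) hC0) h1.le)
    nlinarith [sq_nonneg (‖u‖ - 1)]
  rw [Metric.totallyBounded_iff]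
  intro ε hε
  -- With `η = ε ^ 2 / 20`, the bound of `norm_sub_locLow_sq_le` is at most `5 * η = (ε / 2) ^ 2`.
  obtain ⟨K, R, hKR⟩ := h (ε ^ 2 / 20) (by positivity)
  have hT : TotallyBounded (locLow K R '' s) :=
    ((isCompactOperator_locLow K R).isCompact_closure_image_of_bounded
      hbdd).totallyBounded.subset subset_closure
  obtain ⟨t, ht, hcov⟩ := Metric.totallyBounded_iff.1 hT (ε / 2) (half_pos hε)
  refine ⟨t, ht, fun u hu => ?_⟩
  obtain ⟨y, hy, huy⟩ := Set.mem_iUnion₂.1 (hcov (Set.mem_image_of_mem _ hu))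
  refine Set.mem_iUnion₂.2 ⟨y, hy, ?_⟩
  obtain ⟨h1, h2, h3⟩ := hKR u hu
  have h4 := norm_sub_locLow_sq_le K R u
  have h5 : dist u (locLow K R u) ≤ ε / 2 := by
    rw [dist_eq_norm]
    refine (sq_le_sq₀ (norm_nonneg _) (by positivity)).1 ?_
    nlinarith
  exact (dist_triangle _ _ _).trans_lt (by linarith [Metric.mem_ball.1 huy])

theorem isCompact_closure_orbits {s : Set L2h1} (hs : TotallyBounded s) :
    IsCompact (closure (orbit '' s)) :=
  (hs.closure.isCompact_of_isClosed isClosed_closure |>.image continuous_orbit).closure_of_subset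
    (Set.image_mono subset_closure)

open L2h1

/-! ### Boundedness of the parameters of well-localised translates -/

theorem norm_restr_sym {A B : Set Plane} (hA : MeasurableSet A) (hB : MeasurableSet B)
    (θ : ℝ) (ξ₀ x₀ : Plane) (l : {r : ℝ // 0 < r})
    (h : ∀ x, x ∈ A ↔ l.1⁻¹ • (x - x₀) ∈ B) (u : L2h1) :
    ‖restr hA (sym θ ξ₀ x₀ l u)‖ = ‖restr hB u‖ :=
  norm_eq_of_comp_eq fun _ => norm_cut_symL2 hA hB θ ξ₀ x₀ l h _

theorem fourier_sym (θ : ℝ) (ξ₀ x₀ : Plane) (l : {r : ℝ // 0 < r}) (u : L2h1) :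
    fourier (sym θ ξ₀ x₀ l u) =
      sym (θ + ⟪x₀, ξ₀⟫_ℝ) (-x₀) ξ₀ ⟨l.1⁻¹, inv_pos.2 l.2⟩ (fourier u) :=
  ext_comp fun _ => hatL_symL2 θ ξ₀ x₀ l _

theorem norm_restr_le {A : Set Plane} (hA : MeasurableSet A) (u : L2h1) : ‖restr hA u‖ ≤ ‖u‖ :=
  norm_diag_le u

theorem norm_restr_mono {A B : Set Plane} (hA : MeasurableSet A) (hB : MeasurableSet B)
    (h : A ⊆ B) (u : L2h1) : ‖restr hA u‖ ≤ ‖restr hB u‖ :=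
  norm_le_of_comp_le fun _ => norm_cut_mono hA hB h _

theorem norm_restr_ext_anti {r s : ℝ} (h : r ≤ s) (u : L2h1) :
    ‖restr (measurableSet_ext s) u‖ ≤ ‖restr (measurableSet_ext r) u‖ :=
  norm_restr_mono _ _ (fun _ hx => h.trans hx) u

theorem norm_le_restr_add {A : Set Plane} (hA : MeasurableSet A) (u : L2h1) :
    ‖u‖ ≤ ‖restr hA u‖ + ‖restr hA.compl u‖ := by
  have h : u = restr hA u + restr hA.compl u :=
    ext_comp fun j => (cut_add_cut_compl hA (u.comp j)).symm
  conv_lhs => rw [h]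
  exact norm_add_le _ _

/-- If half of the mass of a translate of `f` lies in a given ball about the origin, then `f` is
neither dilated nor translated much. -/
theorem exists_param_bound {f : L2h1} (hf : f ≠ 0) (R : ℝ) : ∃ L : ℝ, 0 < L ∧
    ∀ (θ : ℝ) (ξ₀ x₀ : Plane) (l : {r : ℝ // 0 < r}),
      ‖restr (measurableSet_ext R) (sym θ ξ₀ x₀ l f)‖ ≤ ‖f‖ / 2 → l.1 ≤ L ∧ ‖x₀‖ ≤ L := by
  have hf2 : 0 < ‖f‖ / 2 := half_pos (norm_pos_iff.2 hf)
  obtain ⟨δ, hδ, hsmall⟩ := exists_norm_restr_lt f hf2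
  obtain ⟨r, hr0, hr⟩ := ((eventually_ge_atTop 0).and
    ((tendsto_restr_ext f).norm.eventually (gt_mem_nhds (show ‖(0 : L2h1)‖ < ‖f‖ / 2 by rwa [norm_zero])))).exists
  set V : ℝ := (volume (Metric.ball (0 : Plane) 1)).toReal
  have hV0 : 0 ≤ V := ENNReal.toReal_nonneg
  -- The set pulled back from the ball of radius `R` is a ball of area `R ^ 2 * V / l ^ 2`. For `l >
  -- L₁` this is at most `δ`, because `l ≤ l ^ 2`, and such a set cannot carry half the norm of `f`.
  set L₁ : ℝ := max 1 (R ^ 2 * V / δ)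
  have hL₁ : 1 ≤ L₁ := le_max_left _ _
  refine ⟨L₁ + |R| + L₁ * r, by positivity, fun θ ξ₀ x₀ l h => ?_⟩
  have hl := l.2
  set B : Set Plane := {y | R ≤ ‖l.1 • y + x₀‖} with hBdef
  have hB : MeasurableSet B :=
    (isClosed_le continuous_const (by fun_prop)).measurableSet
  rw [norm_restr_sym _ hB θ ξ₀ x₀ l fun x => by
    change R ≤ ‖x‖ ↔ R ≤ ‖l.1 • l.1⁻¹ • (x - x₀) + x₀‖
    rw [smul_inv_smul₀ hl.ne', sub_add_cancel]] at h
  have hcompl : ‖f‖ / 2 ≤ ‖restr hB.compl f‖ := by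
    have := norm_le_restr_add hB f
    linarith
  have hmem : ∀ y ∈ Bᶜ, ‖l.1 • y + x₀‖ < R := fun y hy => not_le.1 hy
  have hl₁ : l.1 ≤ L₁ := by
    by_contra! hcon
    refine (hsmall Bᶜ hB.compl ?_).not_ge hcompl
    by_cases hR : R ≤ 0
    · have : Bᶜ = ∅ := Set.eq_empty_of_forall_notMem fun y hy =>
        ((norm_nonneg _).trans_lt (hmem y hy)).not_ge hR
      simp [this]
    push Not at hR
    have hsub : Bᶜ ⊆ Metric.ball (-(l.1⁻¹ • x₀)) (R / l.1) := fun y hy => by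
      rw [mem_ball_iff_norm, sub_neg_eq_add, lt_div_iff₀ hl, mul_comm]
      have h1 := hmem y hy
      have h2 : l.1 • y + x₀ = l.1 • (y + l.1⁻¹ • x₀) := by
        rw [smul_add, smul_inv_smul₀ hl.ne']
      rwa [h2, norm_smul, Real.norm_of_nonneg hl.le] at h1
    refine (measure_mono hsub).trans ?_
    rw [Measure.addHaar_ball_of_pos _ _ (div_pos hR hl), finrank_euclideanSpace, Fintype.card_fin,
      ← ENNReal.ofReal_toReal (measure_ball_lt_top (x := (0 : Plane)) (r := 1)).ne,
      ← ENNReal.ofReal_mul (by positivity)]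
    refine ENNReal.ofReal_le_ofReal ?_
    have h1 : R ^ 2 * V / δ < l.1 := (le_max_right _ _).trans_lt hcon
    rw [div_lt_iff₀ hδ] at h1
    change (R / l.1) ^ 2 * V ≤ δ
    rw [div_pow, div_mul_eq_mul_div, div_le_iff₀ (by positivity)]
    have h2 : l.1 ≤ l.1 ^ 2 := by nlinarith
    nlinarith [mul_le_mul_of_nonneg_right h2 hδ.le]
  have hpos : 0 ≤ L₁ * r := by positivity
  refine ⟨by linarith [abs_nonneg R], ?_⟩
  by_contra! hcon
  -- With the dilation bounded, a far translation pushes the pulled-back ball out of the ball of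
  -- radius `r`, which carries most of `f`.
  have hsub : Bᶜ ⊆ ext r := fun y hy => by
    change r ≤ ‖y‖
    by_contra! hy'
    have h1 := hmem y hy
    have h2 : ‖x₀‖ ≤ ‖l.1 • y + x₀‖ + ‖l.1 • y‖ := by
      have := norm_sub_le (l.1 • y + x₀) (l.1 • y)
      rwa [add_sub_cancel_left] at this
    rw [norm_smul, Real.norm_of_nonneg hl.le] at h2
    have h3 : l.1 * ‖y‖ ≤ L₁ * r := mul_le_mul hl₁ hy'.le (norm_nonneg _) (by positivity)
    linarith [le_abs_self R]
  exact ((norm_restr_mono hB.compl (measurableSet_ext r) hsub f).trans_lt hr).not_ge hcompl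

/-- Translates of `f` with bounded parameters are uniformly concentrated. -/
theorem exists_restr_sym_lt (f : L2h1) (L : ℝ) {η : ℝ} (hη : 0 < η) : ∃ R : ℝ,
    ∀ (θ : ℝ) (ξ₀ x₀ : Plane) (l : {r : ℝ // 0 < r}), l.1 ≤ L → ‖x₀‖ ≤ L →
      ‖restr (measurableSet_ext R) (sym θ ξ₀ x₀ l f)‖ < η := by
  obtain ⟨r, hr0, hr⟩ := ((eventually_ge_atTop 0).and
    ((tendsto_restr_ext f).norm.eventually (gt_mem_nhds (show ‖(0 : L2h1)‖ < η by rwa [norm_zero])))).exists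
  refine ⟨L + L * r, fun θ ξ₀ x₀ l hl hx => ?_⟩
  set B : Set Plane := {y | L + L * r ≤ ‖l.1 • y + x₀‖} with hBdef
  have hB : MeasurableSet B :=
    (isClosed_le continuous_const (by fun_prop)).measurableSet
  rw [norm_restr_sym _ hB θ ξ₀ x₀ l fun x => by
    change L + L * r ≤ ‖x‖ ↔ L + L * r ≤ ‖l.1 • l.1⁻¹ • (x - x₀) + x₀‖
    rw [smul_inv_smul₀ l.2.ne', sub_add_cancel]]
  refine (norm_restr_mono hB (measurableSet_ext r) (fun y hy => ?_) f).trans_lt hr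
  change r ≤ ‖y‖
  have h1 : L + L * r ≤ l.1 * ‖y‖ + ‖x₀‖ := by
    refine le_trans hy ((norm_add_le _ _).trans ?_)
    rw [norm_smul, Real.norm_of_nonneg l.2.le]
  have h2 : l.1 * ‖y‖ ≤ L * ‖y‖ := mul_le_mul_of_nonneg_right hl (norm_nonneg _)
  have hL : 0 < L := l.2.trans_le hl
  exact le_of_mul_le_mul_left (by linarith) hL

/-! ### Normalisation of a function by a symmetry -/

/-- At least three quarters of the norm of `g u` and of its Fourier transform are carried by the
ball of radius `n` about the origin. -/
def IsNormalizer (u : L2h1) (n : ℕ) (g : G) : Prop :=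
  ‖restr (measurableSet_ext n) (g • u)‖ ≤ ‖u‖ / 4 ∧
    ‖restr (measurableSet_ext n) (fourier (g • u))‖ ≤ ‖u‖ / 4

theorem norm_G_smul (g : G) (u : L2h1) : ‖g • u‖ = ‖u‖ := (g : L2h1 ≃ₗᵢ[ℂ] L2h1).norm_map u

theorem G_smul_sub (g : G) (u v : L2h1) : g • (u - v) = g • u - g • v :=
  map_sub (g : L2h1 ≃ₗᵢ[ℂ] L2h1) u v

theorem eventually_restr_le (u : L2h1) {ε : ℝ} (hε : 0 < ε) :
    ∀ᶠ n : ℕ in atTop, ‖restr (measurableSet_ext n) u‖ ≤ ε := by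
  have h := ((tendsto_restr_ext u).comp tendsto_natCast_atTop_atTop).norm
  rw [norm_zero] at h
  exact (h.eventually (gt_mem_nhds hε)).mono fun n hn => le_of_lt hn

theorem exists_isNormalizer (u : L2h1) : ∃ n g, IsNormalizer u n g := by
  by_cases hu : u = 0
  · subst hu
    refine ⟨0, 1, ?_, ?_⟩ <;> simp
  · have hu4 : 0 < ‖u‖ / 4 := by have := norm_pos_iff.2 hu; positivity
    obtain ⟨n, h1, h2⟩ :=
      ((eventually_restr_le u hu4).and (eventually_restr_le (fourier u) hu4)).exists
    exact ⟨n, 1, by simpa using h1, by simpa using h2⟩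

theorem exists_minimal_isNormalizer (u : L2h1) :
    ∃ n g, IsNormalizer u n g ∧ ∀ m h, IsNormalizer u m h → n ≤ m := by
  classical
  obtain ⟨g, hg⟩ := Nat.find_spec (exists_isNormalizer u)
  exact ⟨_, g, hg, fun m h hm => Nat.find_min' (exists_isNormalizer u) ⟨h, hm⟩⟩

/-- A symmetry localising `u` to a ball about the origin in space and frequency whose radius is
essentially the smallest possible. -/
def normalizer (u : L2h1) : G := (exists_minimal_isNormalizer u).choose_spec.choose

/-! ### Uniform concentration of normalised functions. -/

theorem restr_add_le {A : Set Plane} (hA : MeasurableSet A) {u v : L2h1} {ε : ℝ}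
    (h : ‖u - v‖ ≤ ε) : ‖restr hA u‖ ≤ ‖restr hA v‖ + ε := by
  have h1 : restr hA u = restr hA v + restr hA (u - v) := by rw [map_sub]; abel
  rw [h1]
  exact (norm_add_le _ _).trans (add_le_add le_rfl ((norm_restr_le hA _).trans h))

theorem tailMass_eq (K : ℕ) (u : L2h1) : tailMass K u = ‖highModes K u‖ ^ 2 := by
  rw [norm_sq_eq_sum_add_tailMass K (highModes K u), Finset.sum_eq_zero, zero_add]
  · exact tailMass_congr fun j hj => by rw [comp_highModes, if_pos hj]
  · intro j hj
    rw [Finset.mem_Icc, ← abs_le] at hj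
    rw [comp_highModes, if_neg (not_lt.2 hj), norm_zero]
    ring

theorem spaceMass_zero_le (K : ℕ) (R : ℝ) (u : L2h1) :
    spaceMass K 0 R u ≤ ‖restr (measurableSet_ext R) u‖ ^ 2 := by
  rw [spaceMass_zero_eq, L2h1.norm_sq]
  exact (restr (measurableSet_ext R) u).summable_comp.sum_le_tsum _ fun j _ => by positivity

theorem freqMass_zero_le (K : ℕ) (R : ℝ) (u : L2h1) :
    freqMass K 0 R u ≤ ‖restr (measurableSet_ext R) (fourier u)‖ ^ 2 := by
  rw [freqMass_zero_eq, L2h1.norm_sq]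
  exact (restr (measurableSet_ext R) (fourier u)).summable_comp.sum_le_tsum _
    fun j _ => by positivity

theorem norm_highModes_le (K : ℕ) (u : L2h1) : ‖highModes K u‖ ≤ ‖u‖ := norm_diag_le u

theorem norm_highModes_anti {K M : ℕ} (h : K ≤ M) (u : L2h1) :
    ‖highModes M u‖ ≤ ‖highModes K u‖ := by
  refine norm_le_of_comp_le fun j => ?_
  rw [comp_highModes, comp_highModes]
  by_cases hM : (M : ℤ) < |j|
  · rw [if_pos hM, if_pos (lt_of_le_of_lt (by exact_mod_cast h) hM)]
  · rw [if_neg hM, norm_zero]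
    exact norm_nonneg _

theorem norm_highModes_smul (K : ℕ) (g : G) (u : L2h1) :
    ‖highModes K (g • u)‖ = ‖highModes K u‖ := by
  obtain ⟨g, θ, ξ₀, x₀, l, rfl⟩ := g
  refine (sq_eq_sq₀ (norm_nonneg _) (norm_nonneg _)).1 ?_
  rw [← tailMass_eq, ← tailMass_eq]
  exact tailMass_sym K θ ξ₀ x₀ l u

/-- Normalised functions are uniformly concentrated on a neighbourhood of each orbit. -/
theorem exists_nhds_normalizer_lt (f : L2h1) {η : ℝ} (hη : 0 < η) :
    ∃ ε : ℝ, 0 < ε ∧ ∃ (K : ℕ) (R : ℝ), ∀ (u : L2h1) (g : G), ‖g • u - f‖ < ε →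
      ‖highModes K u‖ < η ∧ ‖restr (measurableSet_ext R) (normalizer u • u)‖ < η ∧
        ‖restr (measurableSet_ext R) (fourier (normalizer u • u))‖ < η := by
  by_cases hf : f = 0
  · refine ⟨η, hη, 0, 0, fun u g h => ?_⟩
    rw [hf, sub_zero, norm_G_smul] at h
    refine ⟨(norm_highModes_le 0 u).trans_lt h, ?_, ?_⟩
    · exact ((norm_restr_le _ _).trans_eq (norm_G_smul _ u)).trans_lt h
    · exact (((norm_restr_le _ _).trans_eq (norm_fourier _)).trans_eq
        (norm_G_smul _ u)).trans_lt h
  have hf0 : 0 < ‖f‖ := norm_pos_iff.2 hf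
  have hFf0 : fourier f ≠ 0 := by rwa [← norm_pos_iff, norm_fourier]
  obtain ⟨m, hm1, hm2⟩ := ((eventually_restr_le f (ε := ‖f‖ / 8) (by positivity)).and
    (eventually_restr_le (fourier f) (ε := ‖f‖ / 8) (by positivity))).exists
  obtain ⟨L₁, hL₁, hb₁⟩ := exists_param_bound hf m
  obtain ⟨L₂, hL₂, hb₂⟩ := exists_param_bound hFf0 m
  obtain ⟨R₁, hR₁⟩ := exists_restr_sym_lt f L₁ (half_pos hη)
  obtain ⟨R₂, hR₂⟩ := exists_restr_sym_lt (fourier f) L₂ (half_pos hη)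
  obtain ⟨K, hK⟩ := ((tendsto_highModes f).norm.eventually
    (gt_mem_nhds (show ‖(0 : L2h1)‖ < η / 2 by simpa using half_pos hη))).exists
  -- The fraction `1 / 16` serves twice: `‖f‖ / 8 + ‖f‖ / 16 ≤ ‖u‖ / 4` makes `g₀` admissible with
  -- radius `m`, and `‖u‖ / 4 + ‖f‖ / 16 ≤ ‖f‖ / 2` meets the hypothesis of `exists_param_bound`.
  refine ⟨min (‖f‖ / 16) (η / 2), lt_min (by positivity) (half_pos hη), K, max R₁ R₂,
    fun u g₀ hu => ?_⟩
  have hu1 : ‖g₀ • u - f‖ ≤ ‖f‖ / 16 := (hu.trans_le (min_le_left _ _)).le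
  have hu2 : ‖g₀ • u - f‖ ≤ η / 2 := (hu.trans_le (min_le_right _ _)).le
  have hn1 : ‖u‖ ≤ ‖f‖ + ‖f‖ / 16 := by
    have := norm_le_norm_add_norm_sub' (g₀ • u) f
    rw [norm_G_smul] at this
    linarith
  have hn2 : ‖f‖ - ‖f‖ / 16 ≤ ‖u‖ := by
    have := norm_le_norm_add_norm_sub (g₀ • u) f
    rw [norm_G_smul] at this
    linarith
  have hFsub : ∀ v w : L2h1, ‖fourier v - fourier w‖ = ‖v - w‖ := fun v w => by
    rw [← map_sub, norm_fourier]
  set g := normalizer u with hg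
  obtain ⟨⟨hg1, hg2⟩, hmin⟩ := (exists_minimal_isNormalizer u).choose_spec.choose_spec
  set n := (exists_minimal_isNormalizer u).choose
  -- Here minimality enters: `g₀` already localises `u` at radius `m`, which depends on `f` alone.
  have hnm : n ≤ m := by
    refine hmin m g₀ ⟨?_, ?_⟩
    · have := restr_add_le (measurableSet_ext m) hu1
      linarith
    · have := restr_add_le (measurableSet_ext m) ((hFsub (g₀ • u) f).trans_le hu1)
      linarith
  have hdist : ‖(g * g₀⁻¹) • f - g • u‖ = ‖g₀ • u - f‖ := by
    have h1 : (g * g₀⁻¹) • (f - g₀ • u) = (g * g₀⁻¹) • f - g • u := by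
      rw [G_smul_sub, smul_smul, inv_mul_cancel_right]
    rw [← h1, norm_G_smul, norm_sub_rev]
  have hnm' : (n : ℝ) ≤ m := by exact_mod_cast hnm
  have ha := restr_add_le (measurableSet_ext m) (hdist.trans_le hu1)
  have hb := restr_add_le (measurableSet_ext m)
    ((hFsub ((g * g₀⁻¹) • f) (g • u)).trans_le (hdist.trans_le hu1))
  have ha' := (norm_restr_ext_anti hnm' (g • u)).trans hg1
  have hb' := (norm_restr_ext_anti hnm' (fourier (g • u))).trans hg2
  rw [norm_sub_rev] at hdist
  have hc := restr_add_le (measurableSet_ext (max R₁ R₂)) (hdist.trans_le hu2)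
  have hd := restr_add_le (measurableSet_ext (max R₁ R₂))
    ((hFsub (g • u) ((g * g₀⁻¹) • f)).trans_le (hdist.trans_le hu2))
  obtain ⟨θ, ξ₀, x₀, l, hsym⟩ := (g * g₀⁻¹).2
  have hact : (g * g₀⁻¹) • f = sym θ ξ₀ x₀ l f := by
    change ((g * g₀⁻¹ : G) : L2h1 ≃ₗᵢ[ℂ] L2h1) f = _
    rw [hsym]
  rw [hact] at ha hb hc hd
  rw [fourier_sym] at hb hd
  -- The space side bounds `l` and `x₀`; the Fourier side, where the roles are exchanged, bounds
  -- `l⁻¹` and `ξ₀`.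
  obtain ⟨hp1, hp2⟩ := hb₁ θ ξ₀ x₀ l (by linarith)
  obtain ⟨hp3, hp4⟩ := hb₂ (θ + ⟪x₀, ξ₀⟫_ℝ) (-x₀) ξ₀ ⟨l.1⁻¹, inv_pos.2 l.2⟩
    (by rw [norm_fourier]; linarith)
  refine ⟨?_, ?_, ?_⟩
  · have h1 : highModes K (g₀ • u) = highModes K f + highModes K (g₀ • u - f) := by
      rw [map_sub]; abel
    rw [← norm_highModes_smul K g₀ u, h1]
    have h2 := norm_add_le (highModes K f) (highModes K (g₀ • u - f))
    have h3 := norm_highModes_le K (g₀ • u - f)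
    linarith
  · have h1 := norm_restr_ext_anti (le_max_left R₁ R₂) (sym θ ξ₀ x₀ l f)
    have h2 := hR₁ θ ξ₀ x₀ l hp1 hp2
    linarith
  · have h1 := norm_restr_ext_anti (le_max_right R₁ R₂)
      (sym (θ + ⟪x₀, ξ₀⟫_ℝ) (-x₀) ξ₀ ⟨l.1⁻¹, inv_pos.2 l.2⟩ (fourier f))
    have h2 := hR₂ (θ + ⟪x₀, ξ₀⟫_ℝ) (-x₀) ξ₀ ⟨l.1⁻¹, inv_pos.2 l.2⟩ hp3 hp4
    linarith

/-! ### The characterisation of almost periodicity -/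

/-- The cover and the constants depend on `η`, but the normalising symmetries do not; this gives the
order of quantifiers in statement 3. -/
theorem exists_normalized_bounds {I : Set ℝ} {u : ℝ → L2h1} (h : IsAlmostPeriodicModG I u) {η : ℝ}
    (hη : 0 < η) : ∃ (K : ℕ) (R : ℝ), 0 < K ∧ 0 < R ∧ ∀ t ∈ I,
      ‖highModes K (u t)‖ < η ∧
        ‖restr (measurableSet_ext R) (normalizer (u t) • u t)‖ < η ∧
        ‖restr (measurableSet_ext R) (L2h1.fourier (normalizer (u t) • u t))‖ < η := by
  choose ε hε K R hKR using fun f : L2h1 => exists_nhds_normalizer_lt f hη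
  obtain ⟨T, hT⟩ := IsCompact.elim_finite_subcover h
    (fun f => orbit '' Metric.ball f (ε f)) (fun f => isOpenMap_orbit _ Metric.isOpen_ball)
    (fun p _ => by
      obtain ⟨f, rfl⟩ : ∃ f, orbit f = p := Quotient.exists_rep p
      exact Set.mem_iUnion.2 ⟨f, f, Metric.mem_ball_self (hε f), rfl⟩)
  obtain ⟨M, hM⟩ := (T.image K).exists_le
  obtain ⟨S, hS⟩ := (T.image R).exists_le
  refine ⟨max M 1, max S 1, by positivity, by positivity, fun t ht => ?_⟩
  obtain ⟨f, hfT, v, hv, hvt⟩ :=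
    Set.mem_iUnion₂.1 (hT (subset_closure (show orbit (u t) ∈
      {p : Orbits | ∃ t ∈ I, p = orbit (u t)} from ⟨t, ht, rfl⟩)))
  obtain ⟨g, rfl⟩ := Quotient.exact hvt
  obtain ⟨h1, h2, h3⟩ := hKR f (u t) g (by simpa [dist_eq_norm] using hv)
  have hKM : K f ≤ max M 1 := (hM _ (Finset.mem_image_of_mem K hfT)).trans (le_max_left _ _)
  have hRS : R f ≤ max S 1 := (hS _ (Finset.mem_image_of_mem R hfT)).trans (le_max_left _ _)
  exact ⟨(norm_highModes_anti hKM _).trans_lt h1, (norm_restr_ext_anti hRS _).trans_lt h2,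
    (norm_restr_ext_anti hRS _).trans_lt h3⟩

theorem exists_params_of_isAlmostPeriodicModG {I : Set ℝ} {u : ℝ → L2h1}
    (h : IsAlmostPeriodicModG I u) :
    ∃ (x ξ : ℝ → Plane) (N : ℝ → ℝ), (∀ t ∈ I, 0 < N t) ∧
      ∀ η : ℝ, 0 < η → ∃ (K : ℕ) (R : ℝ), 0 < K ∧ 0 < R ∧ ∀ t ∈ I,
        tailMass K (u t) < η ∧ spaceMass K (x t) (R / N t) (u t) < η ∧
          freqMass K (ξ t) (R * N t) (u t) < η := by
  choose θ ξ₀ x₀ l hg using fun t => (normalizer (u t)).2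
  refine ⟨fun t => -((l t).1⁻¹ • x₀ t), fun t => -((l t).1 • ξ₀ t), fun t => (l t).1,
    fun t _ => (l t).2, fun η hη => ?_⟩
  -- The square root appears because the masses are bounded by squares of norms.
  obtain ⟨K, R, hK, hR, hKR⟩ := exists_normalized_bounds h (Real.sqrt_pos.2 hη)
  refine ⟨K, R, hK, hR, fun t ht => ?_⟩
  obtain ⟨h1, h2, h3⟩ := hKR t ht
  have hact : normalizer (u t) • u t = sym (θ t) (ξ₀ t) (x₀ t) (l t) (u t) := by
    rw [← hg t]
    rfl
  rw [hact] at h2 h3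
  have hsq : ∀ {a : ℝ}, 0 ≤ a → a < Real.sqrt η → a ^ 2 < η := fun ha h => by
    rwa [Real.lt_sqrt ha] at h
  refine ⟨?_, ?_, ?_⟩
  · rw [tailMass_eq]
    exact hsq (norm_nonneg _) h1
  · rw [← spaceMass_sym K (θ t) (ξ₀ t)]
    exact (spaceMass_zero_le K R _).trans_lt (hsq (norm_nonneg _) h2)
  · rw [← freqMass_sym K (θ t) (ξ₀ t) (x₀ t)]
    exact (freqMass_zero_le K R _).trans_lt (hsq (norm_nonneg _) h3)

theorem isAlmostPeriodicModG_of_params {I : Set ℝ} {u : ℝ → L2h1} {x ξ : ℝ → Plane} {N : ℝ → ℝ}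
    (hN : ∀ t ∈ I, 0 < N t)
    (h : ∀ η : ℝ, 0 < η → ∃ (K : ℕ) (R : ℝ), 0 < K ∧ 0 < R ∧ ∀ t ∈ I,
      tailMass K (u t) < η ∧ spaceMass K (x t) (R / N t) (u t) < η ∧
        freqMass K (ξ t) (R * N t) (u t) < η) : IsAlmostPeriodicModG I u := by
  -- The parameters solve the relations of `spaceMass_sym` and `freqMass_sym` for centres `x t`, `ξ
  -- t` and radii `R / N t`, `R * N t`.
  set v : I → L2h1 := fun t =>
    sym 0 (-((N t)⁻¹ • ξ t)) (-(N t • x t)) ⟨N t, hN t t.2⟩ (u t) with hv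
  have hset : {p : Orbits | ∃ t ∈ I, p = orbit (u t)} = orbit '' Set.range v := by
    ext p
    constructor
    · rintro ⟨t, ht, rfl⟩
      exact ⟨_, ⟨⟨t, ht⟩, rfl⟩, orbit_sym _ _ _ _ _⟩
    · rintro ⟨_, ⟨t, rfl⟩, rfl⟩
      exact ⟨t, t.2, orbit_sym _ _ _ _ _⟩
  unfold IsAlmostPeriodicModG IsPrecompact
  rw [hset]
  refine isCompact_closure_orbits (totallyBounded_of_mass_lt fun η hη => ?_)
  obtain ⟨K, R, -, -, hKR⟩ := h η hη
  refine ⟨K, R, ?_⟩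
  rintro _ ⟨t, rfl⟩
  have hx : -((N t)⁻¹ • -(N t • x t)) = x t := by
    rw [smul_neg, neg_neg, inv_smul_smul₀ (hN t t.2).ne']
  have hξ : -(N t • -((N t)⁻¹ • ξ t)) = ξ t := by
    rw [smul_neg, neg_neg, smul_inv_smul₀ (hN t t.2).ne']
  obtain ⟨h1, h2, h3⟩ := hKR t t.2
  refine ⟨by rwa [hv, tailMass_sym], ?_, ?_⟩
  · rw [hv, spaceMass_sym]
    simpa only [hx] using h2
  · rw [hv, freqMass_sym]
    simpa only [hξ] using h3

end ResonantNLS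

end

theorem mainTheorem10 (I : Set ℝ) (hI : I.OrdConnected) (u : ℝ → ResonantNLS.L2h1)
    (hu : ContinuousOn u I) :
    List.TFAE [
      ResonantNLS.IsAlmostPeriodicModG I u,
      ResonantNLS.IsPrecompact {p : ResonantNLS.Orbits | ∃ t ∈ I, p = ResonantNLS.orbit (u t)},
      ∃ (x ξ : ℝ → ResonantNLS.Plane) (N : ℝ → ℝ), (∀ t ∈ I, 0 < N t) ∧
        ∀ η : ℝ, 0 < η → ∃ (K : ℕ) (R : ℝ), 0 < K ∧ 0 < R ∧ ∀ t ∈ I,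
          ResonantNLS.tailMass K (u t) < η ∧
          ResonantNLS.spaceMass K (x t) (R / N t) (u t) < η ∧
          ResonantNLS.freqMass K (ξ t) (R * N t) (u t) < η] := by
  tfae_have 1 ↔ 2 := Iff.rfl
  tfae_have 1 → 3 := ResonantNLS.exists_params_of_isAlmostPeriodicModG
  tfae_have 3 → 1 := fun ⟨_, _, _, hN, h⟩ => ResonantNLS.isAlmostPeriodicModG_of_params hN h
  tfae_finish
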